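/- **Model.** A typical user sits at the origin of the plane. Terrestrial base stations (TBSs) form a homogeneous Poisson point process $\Phi_T$ on $\mathbb R^2$ with density $\lambda_T>0$. Aerial base stations (ABSs) hover at height $h>0$; the horizontal locations of the line-of-sight (LoS) and non-line-of-sight (NLoS) ABSs form Poisson point processes $\Phi_L,\Phi_N$ on $\mathbb R^2$ with intensities $\lambda_A P_L(\|x\|)$ and $\lambda_A P_N(\|x\|)$, where $\lambda_A>0$, $P_N=1-P_L$, and $P_L:[0,\infty)\to(0,1)$ is measurable (for example the S-curve $P_L(x)=1/(1+a\exp(-b(\frac{180}{\pi}\arctan(h/x)-a)))$ with $a>0$, $b\in\mathbb{R}$). The processes $\Phi_T,\Phi_L,\Phi_N$ are independent. Let $R_{T,0}=\inf_{x\in\Phi_T}\|x\|$ and $R_{i,0}=\inf_{x\in\Phi_i}\sqrt{\|x\|^2+h^2}$ for $i\in\{L,N\}$ ($\inf\emptyset=\infty$). Let $R_B>0$, $\alpha_T,\alpha_L,\alpha_N>0$, $\eta_T=G_MP_TC_T$, $\eta_L=a_nP_AC_L$, $\eta_N=a_nP_AC_N$, all factors being positive. The average received powers are $\eta_TR_{T,0}^{-\alpha_T}\mathbf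 1(R_{T,0}\le R_B)$, $\eta_LR_{L,0}^{-\alpha_L}$ and $\eta_NR_{N,0}^{-\alpha_N}$; the user is associated with a TBS, a LoS ABS or a NLoS ABS (events $B_T,B_L,B_N$) if the corresponding power is strictly larger than the two others. Put $A_i=\mathbb P(B_i)$. Let $\hat R_{i,0}$ be the serving distance $R_{i,0}$ under $\mathbb P(\,\cdot\mid B_i)$. Let $E_T$ be the event that some TBS lies in the closed ball $\mathcal B(0,R_B)$, and $Q_T=1-e^{-\pi\lambda_TR_B^2}$. **Notation.** For $i\in\{L,N\}$ put $$V_i(d)=\exp\Big(-2\pi\lambda_A\int_0^{\sqrt{d^2-h^2}}xP_i(x)\,dx\Big),$$ with $V_i(d)=1$ for $0\le d\le h$, and $$f_{R_{i,0}}(r)=2\pi\lambda_A\,r\,P_i(\sqrt{r^2-h^2})\,V_i(r)\ \ (r\ge h),\qquad f_{R_{T,0}}(r)=2\pi\lambda_T\,r\,e^{-\pi\lambda_Tr^2}\ \ (0\le r\le R_B),$$ all zero elsewhere. Put $\tau_{i|j}(r)=(\eta_i/\eta_j)^{1/\alpha_i}r^{\alpha_j/\alpha_i}$ and $l_{L,h}=\tau_{L|N}(h)$,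 $l_{L,T}=\tau_{L|T}(R_B)$, $l_{T,L}=\tau_{T|L}(h)$, $l_{T,N}=\tau_{T|N}(h)$. **Claim.** 1. (NLoS ABS.) Assume that almost surely, on $E_T$, the user is not associated with a NLoS ABS. Then $A_N>0$ and $\hat R_{N,0}$ has the probability density $$f_{\hat R_{N,0}}(r)=\frac{f_{R_{N,0}}(r)}{A_N}\,V_L(\tau_{L|N}(r))\,(1-Q_T).$$ 2. (LoS ABS.) $A_L>0$, and $\hat R_{L,0}$ has the density $f_{\hat R_{L,0},1}+f_{\hat R_{L,0},2}$, where $f_{\hat R_{L,0},1}$ is the part without and $f_{\hat R_{L,0},2}$ the part with a TBS in $\mathcal B(0,R_B)$. That is, for every Borel set $S\subseteq\mathbb R$, $$\mathbb P(R_{L,0}\in S,\,E_T^c\mid B_L)=\int_Sf_{\hat R_{L,0},1}(r)\,dr,\qquad \mathbb P(R_{L,0}\in S,\,E_T\mid B_L)=\int_Sf_{\hat R_{L,0},2}(r)\,dr.$$ Here $$f_{\hat R_{L,0},1}(r)=\begin{cases}\frac{f_{R_{L,0}}(r)}{A_L}(1-Q_T), & r\le l_{L,h},\\ \frac{f_{R_{L,0}}(r)}{A_L}V_N(\tau_{N|L}(r))(1-Q_T),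 & r>l_{L,h}.\end{cases}$$ If $l_{L,h}>l_{L,T}$, then $$f_{\hat R_{L,0},2}(r)=\frac{f_{R_{L,0}}(r)}{A_L}\big[e^{-\pi\lambda_T\tau_{T|L}(r)^2}-(1-Q_T)\big]\quad\text{for } r\le l_{L,T},$$ and it is $0$ for $r>l_{L,T}$. If $l_{L,T}\ge l_{L,h}$, then $$f_{\hat R_{L,0},2}(r)=\begin{cases}\frac{f_{R_{L,0}}(r)}{A_L}\big[e^{-\pi\lambda_T\tau_{T|L}(r)^2}-(1-Q_T)\big], & r\le l_{L,h},\\ \frac{f_{R_{L,0}}(r)}{A_L}\big[e^{-\pi\lambda_T\tau_{T|L}(r)^2}-(1-Q_T)\big]V_N(\tau_{N|L}(r)), & l_{L,h}<r\le l_{L,T},\\ 0, & r>l_{L,T}.\end{cases}$$ (All of these vanish for $r<h$, because $f_{R_{L,0}}$ does.) 3. (TBS.) If $l_{T,L}\le R_B\le l_{T,N}$, then $A_T>0$ and $\hat R_{T,0}$ has the probability density $$f_{\hat R_{T,0}}(r)=\begin{cases}\frac{f_{R_{T,0}}(r)}{A_T}, & r\le l_{T,L},\\ \frac{f_{R_{T,0}}(r)}{A_T}V_L(\tau_{L|T}(r)),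 & l_{T,L}<r\le R_B,\end{cases}$$ and it is $0$ outside $[0,R_B]$. -/

import Mathlib

open MeasureTheory ProbabilityTheory
open scoped ENNReal NNReal

noncomputable section

namespace UAVHetNet

/-- The ground plane `ℝ²`; the typical UE sits at the origin. -/
abbrev Plane : Type := EuclideanSpace ℝ (Fin 2)

/-! ### Poisson point processes -/

/-- The number of points of the random set `Φ` that lie in `B`. -/
def count {Ω E : Type*} (Φ : Ω → Set E) (B : Set E) (ω : Ω) : ℕ∞ := (Φ ω ∩ B).encard

/-- `Φ` is a (simple) Poisson point process with intensity measure `Λ`: numbers of points in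
measurable sets are random variables, Poisson with mean `Λ B` whenever this is finite, and
independent over pairwise disjoint sets. -/
structure IsPoissonProcess {Ω E : Type*} [MeasurableSpace Ω] [MeasurableSpace E]
    (μ : Measure Ω) (Λ : Measure E) (Φ : Ω → Set E) : Prop where
  measurable_count : ∀ B : Set E, MeasurableSet B → Measurable (count Φ B)
  law_count : ∀ B : Set E, MeasurableSet B → Λ B ≠ ∞ →
    μ.map (count Φ B) = (poissonMeasure (Λ B).toNNReal).map (Nat.cast : ℕ → ℕ∞)
  indep_count : ∀ (n : ℕ) (B : Fin n → Set E), (∀ i, MeasurableSet (B i)) →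
    Pairwise (fun i j => Disjoint (B i) (B j)) → iIndepFun (fun i => count Φ (B i)) μ

/-- The σ-algebra generated by a random point set, i.e. by all its counting variables. -/
abbrev sigmaOf {Ω E : Type*} [MeasurableSpace E] (Φ : Ω → Set E) : MeasurableSpace Ω :=
  ⨆ (B : Set E) (_ : MeasurableSet B), MeasurableSpace.comap (count Φ B) inferInstance

/-! ### Parameters of the network -/

/-- Deterministic parameters: ABS height `h`, densities `lamT`, `lamA` of TBSs and ABSs, mmWave LoS
radius `RB`, transmit powers `PT`, `PA`, main-lobe gain `GM`, near-user power allocation factor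
`an`, additive losses `CT`, `CL`, `CN` and path loss exponents `αT`, `αL`, `αN`. -/
structure Network where
  h : ℝ
  lamT : ℝ
  lamA : ℝ
  RB : ℝ
  PT : ℝ
  PA : ℝ
  GM : ℝ
  an : ℝ
  CT : ℝ
  CL : ℝ
  CN : ℝ
  αT : ℝ
  αL : ℝ
  αN : ℝ
  h_pos : 0 < h
  lamT_pos : 0 < lamT
  lamA_pos : 0 < lamA
  RB_pos : 0 < RB
  PT_pos : 0 < PT
  PA_pos : 0 < PA
  GM_pos : 0 < GM
  an_pos : 0 < an
  CT_pos : 0 < CT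
  CL_pos : 0 < CL
  CN_pos : 0 < CN
  αT_pos : 0 < αT
  αL_pos : 0 < αL
  αN_pos : 0 < αN

/-- Admissible LoS probability functions of the horizontal distance `x ≥ 0`. The result holds for
all of them; the S-curve model is an instance, see `isLoSProbability_sCurve`. -/
structure IsLoSProbability (PL : ℝ → ℝ) : Prop where
  measurable : Measurable PL
  pos : ∀ x, 0 ≤ x → 0 < PL x
  lt_one : ∀ x, 0 ≤ x → PL x < 1

/-- S-curve LoS probability with environment parameters `a`, `b` at height `h`. -/
def sCurve (a b h x : ℝ) : ℝ :=
  1 / (1 + a * Real.exp (-b * (180 / Real.pi * Real.arctan (h / x) - a)))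

/-- The variant of the S-curve with the shift `a` inside the arctangent. -/
def sCurve' (a b h x : ℝ) : ℝ :=
  1 / (1 + a * Real.exp (-b * (180 / Real.pi) * Real.arctan (h / x - a)))

theorem isLoSProbability_sCurve {a : ℝ} (ha : 0 < a) (b h : ℝ) :
    IsLoSProbability (sCurve a b h) where
  measurable := by unfold sCurve; fun_prop
  pos x _ := by unfold sCurve; positivity
  lt_one x _ := by
    unfold sCurve
    rw [div_lt_one (by positivity)]
    have : 0 < a * Real.exp (-b * (180 / Real.pi * Real.arctan (h / x) - a)) := by positivity
    linarith

theorem isLoSProbability_sCurve' {a : ℝ} (ha : 0 < a) (b h : ℝ) :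
    IsLoSProbability (sCurve' a b h) where
  measurable := by unfold sCurve'; fun_prop
  pos x _ := by unfold sCurve'; positivity
  lt_one x _ := by
    unfold sCurve'
    rw [div_lt_one (by positivity)]
    have : 0 < a * Real.exp (-b * (180 / Real.pi) * Real.arctan (h / x - a)) := by positivity
    linarith

namespace Network

variable (n : Network)

/-- `η_T = G_M P_T C_T`. -/
def ηT : ℝ := n.GM * n.PT * n.CT

/-- `η_L = a_n P_A C_L`. -/
def ηL : ℝ := n.an * n.PA * n.CL

/-- `η_N = a_n P_A C_N`. -/
def ηN : ℝ := n.an * n.PA * n.CN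

/-- Intensity measure of the TBSs. -/
def intensityT : Measure Plane := ENNReal.ofReal n.lamT • volume

/-- Intensity measure of the LoS ABSs (horizontal locations). -/
def intensityL (PL : ℝ → ℝ) : Measure Plane :=
  volume.withDensity fun x => ENNReal.ofReal (n.lamA * PL ‖x‖)

/-- Intensity measure of the NLoS ABSs (horizontal locations). -/
def intensityN (PL : ℝ → ℝ) : Measure Plane :=
  volume.withDensity fun x => ENNReal.ofReal (n.lamA * (1 - PL ‖x‖))

end Network

/-! ### The random network and the user association -/

/-- The random sets of (horizontal) locations of the TBSs, LoS ABSs and NLoS ABSs. -/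
structure BaseStations (Ω : Type*) where
  tbs : Ω → Set Plane
  los : Ω → Set Plane
  nlos : Ω → Set Plane

/-- TBSs, LoS ABSs and NLoS ABSs form independent Poisson processes with intensities `λ_T`,
`λ_A P_L(‖x‖)` and `λ_A P_N(‖x‖)`, where `P_N = 1 - P_L`. -/
structure IsHetNet {Ω : Type*} [MeasurableSpace Ω] (μ : Measure Ω) (n : Network) (PL : ℝ → ℝ)
    (Φ : BaseStations Ω) : Prop where
  tbs : IsPoissonProcess μ n.intensityT Φ.tbs
  los : IsPoissonProcess μ (n.intensityL PL) Φ.los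
  nlos : IsPoissonProcess μ (n.intensityN PL) Φ.nlos
  indep : iIndep ![sigmaOf Φ.tbs, sigmaOf Φ.los, sigmaOf Φ.nlos] μ

/-- Minimum over the points `x` of `S` of the distance between the typical UE at the origin and a
station above `x` at height `z` (equal to `∞` if `S` is empty). -/
def minDist (z : ℝ) (S : Set Plane) : ℝ≥0∞ :=
  ⨅ x ∈ S, ENNReal.ofReal (√(‖x‖ ^ 2 + z ^ 2))

section Association

variable {Ω : Type*} (n : Network) (Φ : BaseStations Ω)

/-- `R_{T,0}`. -/
def distT (ω : Ω) : ℝ≥0∞ := minDist 0 (Φ.tbs ω)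

/-- `R_{L,0}`. -/
def distL (ω : Ω) : ℝ≥0∞ := minDist n.h (Φ.los ω)

/-- `R_{N,0}`. -/
def distN (ω : Ω) : ℝ≥0∞ := minDist n.h (Φ.nlos ω)

open Classical in
/-- Average received power from the nearest TBS, `η_T R_{T,0}^{-α_T}` within the LoS ball and `0`
outside of it. -/
def powT (ω : Ω) : ℝ≥0∞ :=
  if distT Φ ω ≤ ENNReal.ofReal n.RB then ENNReal.ofReal n.ηT * distT Φ ω ^ (-n.αT) else 0

/-- Average received power from the nearest LoS ABS, `η_L R_{L,0}^{-α_L}`. -/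
def powL (ω : Ω) : ℝ≥0∞ := ENNReal.ofReal n.ηL * distL n Φ ω ^ (-n.αL)

/-- Average received power from the nearest NLoS ABS, `η_N R_{N,0}^{-α_N}`. -/
def powN (ω : Ω) : ℝ≥0∞ := ENNReal.ofReal n.ηN * distN n Φ ω ^ (-n.αN)

/-- The event that the typical UE is associated with a TBS. -/
def assocT : Set Ω := {ω | powL n Φ ω < powT n Φ ω ∧ powN n Φ ω < powT n Φ ω}

/-- The event that the typical UE is associated with a LoS ABS. -/
def assocL : Set Ω := {ω | powT n Φ ω < powL n Φ ω ∧ powN n Φ ω < powL n Φ ω}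

/-- The event that the typical UE is associated with a NLoS ABS. -/
def assocN : Set Ω := {ω | powT n Φ ω < powN n Φ ω ∧ powL n Φ ω < powN n Φ ω}

/-- The event that some TBS lies in the LoS ball `B(0, R_B)`. -/
def tbsInBall : Set Ω := {ω | (Φ.tbs ω ∩ Metric.closedBall 0 n.RB).Nonempty}

end Association

/-! ### Explicit expressions -/

namespace Network

variable (n : Network) (PL : ℝ → ℝ)

/-- `Q_T = 1 - exp (-π λ_T R_B²)`, the probability of a TBS in `B(0, R_B)`. -/
def QT : ℝ := 1 - Real.exp (-Real.pi * n.lamT * n.RB ^ 2)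

/-- `exp (-2πλ_A ∫₀^{√(d² - h²)} x P_L(x) dx)`, the probability of no LoS ABS within distance `d`
(equal to `1` for `0 ≤ d ≤ h`, as `√` vanishes on negative numbers). -/
def voidL (d : ℝ) : ℝ :=
  Real.exp (-2 * Real.pi * n.lamA * ∫ x in (0 : ℝ)..√(d ^ 2 - n.h ^ 2), x * PL x)

/-- `exp (-2πλ_A ∫₀^{√(d² - h²)} x P_N(x) dx)`, the same for NLoS ABSs. -/
def voidN (d : ℝ) : ℝ :=
  Real.exp (-2 * Real.pi * n.lamA * ∫ x in (0 : ℝ)..√(d ^ 2 - n.h ^ 2), x * (1 - PL x))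

/-- The PDF of `R_{L,0}`. -/
def pdfL (r : ℝ) : ℝ :=
  if n.h ≤ r then
    2 * Real.pi * n.lamA * r * PL (√(r ^ 2 - n.h ^ 2)) * n.voidL PL r
  else 0

/-- The PDF of `R_{N,0}`. -/
def pdfN (r : ℝ) : ℝ :=
  if n.h ≤ r then
    2 * Real.pi * n.lamA * r * (1 - PL (√(r ^ 2 - n.h ^ 2))) * n.voidN PL r
  else 0

/-- The PDF of `R_{T,0}` on `[0, R_B]`. -/
def pdfT (r : ℝ) : ℝ :=
  if 0 ≤ r ∧ r ≤ n.RB then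
    2 * Real.pi * n.lamT * r * Real.exp (-Real.pi * n.lamT * r ^ 2)
  else 0

/-- `τ_{L|N}(r)`. -/
def τLN (r : ℝ) : ℝ := (n.ηL / n.ηN) ^ (1 / n.αL) * r ^ (n.αN / n.αL)

/-- `τ_{N|L}(r)` for `r > l_{L,h}`. -/
def τNL (r : ℝ) : ℝ := (n.ηN / n.ηL) ^ (1 / n.αN) * r ^ (n.αL / n.αN)

/-- `τ_{T|L}(r)`. -/
def τTL (r : ℝ) : ℝ := (n.ηT / n.ηL) ^ (1 / n.αT) * r ^ (n.αL / n.αT)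

/-- `τ_{L|T}(r)` for `r > l_{T,L}`. -/
def τLT (r : ℝ) : ℝ := (n.ηL / n.ηT) ^ (1 / n.αL) * r ^ (n.αT / n.αL)

/-- `l_{L,h} = (η_L/η_N)^{1/α_L} h^{α_N/α_L}`. -/
def lLh : ℝ := (n.ηL / n.ηN) ^ (1 / n.αL) * n.h ^ (n.αN / n.αL)

/-- `l_{L,T} = (η_L/η_T)^{1/α_L} R_B^{α_T/α_L}`. -/
def lLT : ℝ := (n.ηL / n.ηT) ^ (1 / n.αL) * n.RB ^ (n.αT / n.αL)

/-- `l_{T,L} = (η_T/η_L)^{1/α_T} h^{α_L/α_T}`. -/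
def lTL : ℝ := (n.ηT / n.ηL) ^ (1 / n.αT) * n.h ^ (n.αL / n.αT)

/-- `l_{T,N} = (η_T/η_N)^{1/α_T} h^{α_N/α_T}`. -/
def lTN : ℝ := (n.ηT / n.ηN) ^ (1 / n.αT) * n.h ^ (n.αN / n.αT)

/-- Density of the serving distance given association with a NLoS ABS; `A` stands for the
association probability `A_N`. -/
def servingPdfN (A r : ℝ) : ℝ :=
  n.pdfN PL r / A * n.voidL PL (n.τLN r) * (1 - n.QT)

/-- Density of the serving distance given association with a LoS ABS, part without a TBS in
`B(0, R_B)`; `A` stands for `A_L`. -/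
def servingPdfL1 (A r : ℝ) : ℝ :=
  if r ≤ n.lLh then n.pdfL PL r / A * (1 - n.QT)
  else n.pdfL PL r / A * n.voidN PL (n.τNL r) * (1 - n.QT)

/-- Density of the serving distance given association with a LoS ABS, part with a TBS in
`B(0, R_B)`; `A` stands for `A_L`. -/
def servingPdfL2 (A r : ℝ) : ℝ :=
  if n.lLT < n.lLh then
    if r ≤ n.lLT then
      n.pdfL PL r / A * (Real.exp (-Real.pi * n.lamT * n.τTL r ^ 2) - (1 - n.QT))
    else 0
  else
    if r ≤ n.lLh then
      n.pdfL PL r / A * (Real.exp (-Real.pi * n.lamT * n.τTL r ^ 2) - (1 - n.QT))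
    else if r ≤ n.lLT then
      n.pdfL PL r / A * (Real.exp (-Real.pi * n.lamT * n.τTL r ^ 2) - (1 - n.QT)) *
        n.voidN PL (n.τNL r)
    else 0

/-- Density of the serving distance given association with a TBS; `A` stands for `A_T`. -/
def servingPdfT (A r : ℝ) : ℝ :=
  if r ≤ n.lTL then n.pdfT r / A
  else n.pdfT r / A * n.voidL PL (n.τLT r)

end Network

/-- The real random variable `X` has (nonnegative, measurable) density `f` under `ν`:
`ν (X ∈ S) = ∫_S f(r) dr` for all Borel sets `S`. -/
def HasDensity {Ω : Type*} [MeasurableSpace Ω] (ν : Measure Ω) (X : Ω → ℝ) (f : ℝ → ℝ) : Prop :=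
  AEMeasurable X ν ∧ (∀ r, 0 ≤ f r) ∧ Measurable f ∧
    ν.map X = (volume : Measure ℝ).withDensity fun r => ENNReal.ofReal (f r)

end UAVHetNet

end

open UAVHetNet

namespace UAVHetNet

/-! ### Absolutely continuous exponentials -/

/-! Each nearest-station distance is governed by void probabilities: no station lies within distance
`d` exactly when a Poisson count in a disc is zero, which has probability `radialVoid`.
Differentiating the void probability gives the density of the finite part of the distance
(`IsPoissonProcess.map_minDist`). The thinning probability is merely measurable, so the
differentiation is legitimate only almost everywhere and rests on absolute continuity
(`integral_mul_exp_neg_primitive`). The three tiers are instances of one radial model; the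
terrestrial one has height `0` and thinning probability `1`.

Comparing received powers amounts to comparing distances: if the serving station is at distance `r`,
a competitor is weaker iff it is farther than `equivDist` at `r` (`lt_mul_rpow_neg_iff`). Up to null
sets, each association event, split by the presence of a TBS in the ball where needed, therefore
asks that the serving distance be finite and that each of the other two distances satisfy a
condition depending only on itself and on `r`. By independence and Fubini, the serving distance on
such an event has its own density multiplied by the probabilities of the two conditions at `r`
(`map_toReal_restrict_of_indepFun₂`). Conditioning divides by the probability of the event, which is
positive because the density obtained is positive on an interval.

The case distinctions in the claimed formulas are not probabilistic. A void factor equals `1` when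
its threshold is below the height of the ABSs, and the TBS factor vanishes once its threshold
exceeds `R_B`. `servingPdfL1_eq`, `servingPdfL2_eq` and `servingPdfT_eq` merge the cases into single
products. -/

theorem locallyIntegrable_of_abs_le_mul {q : ℝ → ℝ} (hq : Measurable q) {K : ℝ}
    (hK : ∀ x, |q x| ≤ K * |x|) : LocallyIntegrable q := by
  have hc : LocallyIntegrable (fun x : ℝ => K * |x|) :=
    (by fun_prop : Continuous fun x : ℝ => K * |x|).locallyIntegrable
  refine hc.mono hq.aestronglyMeasurable (ae_of_all _ fun x => ?_)
  rw [Real.norm_eq_abs, Real.norm_eq_abs]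
  exact (hK x).trans (le_abs_self _)

theorem intervalIntegrable_of_abs_le_mul {q : ℝ → ℝ} (hq : Measurable q) {K : ℝ}
    (hK : ∀ x, |q x| ≤ K * |x|) (a b : ℝ) : IntervalIntegrable q volume a b :=
  intervalIntegrable_iff.2 <|
    ((locallyIntegrable_of_abs_le_mul hq hK).integrableOn_isCompact isCompact_uIcc).mono_set
      Set.uIoc_subset_uIcc

theorem abs_primitive_sub_le {q : ℝ → ℝ} (hq : Measurable q) {K : ℝ} (hK0 : 0 ≤ K)
    (hK : ∀ x, |q x| ≤ K * |x|) (c : ℝ) {a b x y : ℝ} (hx : x ∈ Set.uIcc a b)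
    (hy : y ∈ Set.uIcc a b) :
    |(∫ t in c..x, q t) - ∫ t in c..y, q t| ≤ K * max |a| |b| * |x - y| := by
  have hi := intervalIntegrable_of_abs_le_mul hq hK
  rw [intervalIntegral.integral_interval_sub_left (hi _ _) (hi _ _)]
  rw [← Real.norm_eq_abs]
  refine intervalIntegral.norm_integral_le_of_norm_le_const fun t ht => ?_
  have ht' : t ∈ Set.uIcc a b :=
    (Set.uIcc_subset_uIcc hy hx) (Set.uIoc_subset_uIcc ht)
  rw [Real.norm_eq_abs]
  refine (hK t).trans (mul_le_mul_of_nonneg_left ?_ hK0)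
  exact Set.mem_Icc.1 ht' |> fun h => by
    rcases le_total a b with hab | hab <;>
      simp only [hab, inf_of_le_left, inf_of_le_right, sup_of_le_right, sup_of_le_left] at h <;>
      rcases abs_cases t with h1 | h1 <;> rw [h1.1, le_max_iff]
    · exact .inr (h.2.trans (le_abs_self _))
    · exact .inl ((neg_le_neg h.1).trans (neg_le_abs _))
    · exact .inl (h.2.trans (le_abs_self _))
    · exact .inr ((neg_le_neg h.1).trans (neg_le_abs _))

/-- Since `q` need not be continuous, the pointwise fundamental theorem of calculus is unavailable.
The exponential of the primitive is Lipschitz on a bounded interval, hence absolutely continuous, so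
it suffices to know its derivative almost everywhere, which Lebesgue differentiation supplies. -/
theorem integral_mul_exp_neg_primitive {q : ℝ → ℝ} (hq : Measurable q) {K : ℝ}
    (hK : ∀ x, |q x| ≤ K * |x|) (c a b : ℝ) :
    ∫ x in a..b, q x * Real.exp (-∫ t in c..x, q t) =
      Real.exp (-∫ t in c..a, q t) - Real.exp (-∫ t in c..b, q t) := by
  have hK0 : 0 ≤ K := by simpa using (abs_nonneg _).trans (hK 1)
  set F : ℝ → ℝ := fun x => -∫ t in c..x, q t with hF
  have hcont : Continuous F :=
    (intervalIntegral.continuous_primitive (intervalIntegrable_of_abs_le_mul hq hK) c).neg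
  -- `Real.exp` is Lipschitz only on half-lines bounded above, so an upper bound of `F` on the
  -- interval is needed.
  obtain ⟨M, hM⟩ := (isCompact_uIcc (a := a) (b := b)).bddAbove_image hcont.continuousOn
  have hexp : LipschitzOnWith (Real.toNNReal (Real.exp M)) Real.exp (Set.Iic M) := by
    refine (convex_Iic M).lipschitzOnWith_of_nnnorm_deriv_le
      (fun x _ => Real.differentiableAt_exp) fun x hx => ?_
    rw [Real.deriv_exp, ← NNReal.coe_le_coe, Real.coe_toNNReal _ (Real.exp_pos _).le, coe_nnnorm,
      Real.norm_eq_abs, Real.abs_exp]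
    exact Real.exp_le_exp.2 hx
  have hFL : LipschitzOnWith (Real.toNNReal (K * max |a| |b|)) F (Set.uIcc a b) := by
    refine LipschitzOnWith.of_dist_le_mul fun x hx y hy => ?_
    rw [Real.coe_toNNReal _ (by positivity), Real.dist_eq, Real.dist_eq]
    convert abs_primitive_sub_le hq hK0 hK c hx hy using 1
    rw [hF, ← abs_neg]; congr 1; ring
  have hAC : AbsolutelyContinuousOnInterval (fun x => Real.exp (F x)) a b :=
    (hexp.comp hFL fun x hx => hM ⟨x, hx, rfl⟩).absolutelyContinuousOnInterval
  have hderiv : ∀ᵐ x, deriv (fun x => Real.exp (F x)) x = -(q x * Real.exp (F x)) := by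
    filter_upwards [LocallyIntegrable.ae_hasDerivAt_integral (locallyIntegrable_of_abs_le_mul hq hK)] with x hx
    have hd : HasDerivAt (fun x => Real.exp (F x)) (Real.exp (F x) * -q x) x := (hx c).neg.exp
    rw [hd.deriv]; ring
  have h := hAC.integral_deriv_eq_sub
  rw [intervalIntegral.integral_congr_ae (hderiv.mono fun x hx _ => hx),
    intervalIntegral.integral_neg] at h
  linarith

/-! ### Void probabilities and contact distance densities of radial intensities -/

/-- `exp (-2πc ∫₀^{√(d² - z²)} x p(x) dx)`. -/
noncomputable def radialVoid (c z : ℝ) (p : ℝ → ℝ) (d : ℝ) : ℝ :=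
  Real.exp (-2 * Real.pi * c * ∫ x in (0 : ℝ)..√(d ^ 2 - z ^ 2), x * p x)

/-- Minus the derivative of `radialVoid`. -/
noncomputable def radialPdf (c z : ℝ) (p : ℝ → ℝ) (r : ℝ) : ℝ :=
  if z ≤ r then 2 * Real.pi * c * r * p (√(r ^ 2 - z ^ 2)) * radialVoid c z p r else 0

/-- The parameters of a radial intensity: density `c`, height `z`, thinning probability `p`. -/
structure IsRadial (c z : ℝ) (p : ℝ → ℝ) : Prop where
  c_pos : 0 < c
  z_nonneg : 0 ≤ z
  measurable : Measurable p
  pos : ∀ x, 0 ≤ x → 0 < p x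
  le_one : ∀ x, 0 ≤ x → p x ≤ 1

variable {c z : ℝ} {p : ℝ → ℝ}

theorem radialVoid_pos (d : ℝ) : 0 < radialVoid c z p d := Real.exp_pos _

theorem radialVoid_of_le {d : ℝ} (hd : 0 ≤ d) (hdz : d ≤ z) : radialVoid c z p d = 1 := by
  have : √(d ^ 2 - z ^ 2) = 0 := Real.sqrt_eq_zero_of_nonpos (by nlinarith)
  simp [radialVoid, this]

namespace IsRadial

theorem abs_le (h : IsRadial c z p) {x : ℝ} (hx : 0 ≤ x) : |p x| ≤ 1 := by
  rw [abs_of_pos (h.pos x hx)]; exact h.le_one x hx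

theorem continuous_radialVoid (h : IsRadial c z p) : Continuous (radialVoid c z p) := by
  have hm := h.measurable
  -- `p` is controlled only on nonnegative arguments. Replacing it by `p |x|` gives a global linear
  -- bound without changing the integral.
  have hprim : Continuous fun y : ℝ => ∫ x in (0 : ℝ)..y, x * p |x| := by
    refine intervalIntegral.continuous_primitive
      (intervalIntegrable_of_abs_le_mul (K := 1) (by fun_prop) fun x => ?_) 0
    rw [abs_mul, mul_comm]
    exact mul_le_mul_of_nonneg_right (h.abs_le (abs_nonneg x)) (abs_nonneg x)
  have heq : radialVoid c z p = fun d =>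
      Real.exp (-2 * Real.pi * c * ∫ x in (0 : ℝ)..√(d ^ 2 - z ^ 2), x * p |x|) := by
    funext d
    unfold radialVoid
    congr 2
    refine intervalIntegral.integral_congr fun x hx => ?_
    rw [Set.uIcc_of_le (Real.sqrt_nonneg _)] at hx
    simp only [abs_of_nonneg hx.1]
  rw [heq]
  have : Continuous fun d : ℝ => √(d ^ 2 - z ^ 2) := by fun_prop
  exact Real.continuous_exp.comp (continuous_const.mul (hprim.comp this))

theorem radialPdf_nonneg (h : IsRadial c z p) (r : ℝ) : 0 ≤ radialPdf c z p r := by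
  unfold radialPdf
  split_ifs with hr
  · have := (h.pos _ (Real.sqrt_nonneg (r ^ 2 - z ^ 2))).le
    have := h.z_nonneg.trans hr
    have := h.c_pos.le
    have := (radialVoid_pos (c := c) (z := z) (p := p) r).le
    positivity
  · rfl

theorem radialPdf_pos (h : IsRadial c z p) {r : ℝ} (hr : z < r) : 0 < radialPdf c z p r := by
  rw [radialPdf, if_pos hr.le]
  have := h.pos _ (Real.sqrt_nonneg (r ^ 2 - z ^ 2))
  have := h.z_nonneg.trans_lt hr
  have := h.c_pos
  have := radialVoid_pos (c := c) (z := z) (p := p) r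
  positivity

theorem measurable_radialPdf (h : IsRadial c z p) : Measurable (radialPdf c z p) := by
  have := h.measurable
  have := h.continuous_radialVoid.measurable
  unfold radialPdf
  exact Measurable.ite measurableSet_Ici (by fun_prop) measurable_const

/-- Substitution `x = √(r² - z²)`, for which `x dx = r dr`. It is done on open intervals, because
the square root may fail to be differentiable at `r = z`. -/
theorem integral_sqrt_sub (h : IsRadial c z p) {d : ℝ} (hd : z ≤ d) :
    ∫ x in (0 : ℝ)..√(d ^ 2 - z ^ 2), x * p x = ∫ r in z..d, r * p (√(r ^ 2 - z ^ 2)) := by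
  have hz := h.z_nonneg
  have hpos : ∀ r ∈ Set.Ioo z d, 0 < r ^ 2 - z ^ 2 := fun r hr => by nlinarith [hr.1]
  have hderiv : ∀ r ∈ Set.Ioo z d, HasDerivWithinAt (fun r => √(r ^ 2 - z ^ 2))
      (r / √(r ^ 2 - z ^ 2)) (Set.Ioo z d) r := fun r hr => by
    have h1 : HasDerivAt (fun r : ℝ => r ^ 2 - z ^ 2) (2 * r) r := by
      simpa using (hasDerivAt_pow 2 r).sub_const (z ^ 2)
    have h2 := (h1.sqrt (hpos r hr).ne').hasDerivWithinAt (s := Set.Ioo z d)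
    rwa [mul_div_mul_left _ _ two_ne_zero] at h2
  have hinj : Set.InjOn (fun r => √(r ^ 2 - z ^ 2)) (Set.Ioo z d) := fun r hr s hs hrs => by
    have h2 := (Real.sqrt_inj (hpos r hr).le (hpos s hs).le).1 hrs
    have hr1 := hr.1
    have hs1 := hs.1
    nlinarith
  have himg : (fun r => √(r ^ 2 - z ^ 2)) '' Set.Ioo z d = Set.Ioo 0 (√(d ^ 2 - z ^ 2)) := by
    ext x
    constructor
    · rintro ⟨r, hr, rfl⟩
      refine ⟨Real.sqrt_pos.2 (hpos r hr), Real.sqrt_lt_sqrt (hpos r hr).le ?_⟩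
      have hr1 := hr.1
      have hr2 := hr.2
      nlinarith
    · rintro ⟨hx0, hx1⟩
      have hx2 := (Real.lt_sqrt hx0.le).1 hx1
      refine ⟨√(x ^ 2 + z ^ 2), ⟨Real.lt_sqrt_of_sq_lt (by nlinarith), ?_⟩, ?_⟩
      · rw [Real.sqrt_lt' (by nlinarith [hz, hd, sq_nonneg x])]
        linarith
      · simp only
        rw [Real.sq_sqrt (by positivity), add_sub_cancel_right, Real.sqrt_sq hx0.le]
  rw [intervalIntegral.integral_of_le (Real.sqrt_nonneg _), intervalIntegral.integral_of_le hd,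
    integral_Ioc_eq_integral_Ioo, integral_Ioc_eq_integral_Ioo, ← himg,
    integral_image_eq_integral_abs_deriv_smul measurableSet_Ioo hderiv hinj]
  refine setIntegral_congr_fun measurableSet_Ioo fun r hr => ?_
  have h3 := Real.sqrt_pos.2 (hpos r hr)
  have h4 : 0 < r := hz.trans_lt hr.1
  simp only [smul_eq_mul]
  rw [abs_of_pos (by positivity)]
  field_simp

/-- In the variable `r` the void probability is the exponential of minus a primitive, and its
integrand times that exponential is the density. -/
theorem integral_radialPdf (h : IsRadial c z p) {a b : ℝ} (ha : z ≤ a) (hab : a ≤ b) :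
    ∫ r in a..b, radialPdf c z p r = radialVoid c z p a - radialVoid c z p b := by
  have hm := h.measurable
  have hc := h.c_pos
  have hV : ∀ d, z ≤ d → radialVoid c z p d =
      Real.exp (-∫ r in z..d, 2 * Real.pi * c * (r * p (√(r ^ 2 - z ^ 2)))) := fun d hd => by
    rw [radialVoid, h.integral_sqrt_sub hd, intervalIntegral.integral_const_mul]
    congr 1; ring
  have hmain := integral_mul_exp_neg_primitive
    (q := fun r => 2 * Real.pi * c * (r * p (√(r ^ 2 - z ^ 2)))) (by fun_prop)
    (K := 2 * Real.pi * c) (fun x => by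
      rw [abs_mul, abs_of_pos (by positivity), abs_mul]
      refine mul_le_mul_of_nonneg_left ?_ (by positivity)
      exact mul_le_of_le_one_right (abs_nonneg _) (h.abs_le (Real.sqrt_nonneg _))) z a b
  rw [hV a ha, hV b (ha.trans hab), ← hmain]
  refine intervalIntegral.integral_congr fun r hr => ?_
  rw [Set.uIcc_of_le hab] at hr
  have hzr := ha.trans hr.1
  simp only [radialPdf, if_pos hzr, hV r hzr]
  ring

theorem radialVoid_le_one (h : IsRadial c z p) (d : ℝ) : radialVoid c z p d ≤ 1 := by
  rw [radialVoid, Real.exp_le_one_iff]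
  have : 0 ≤ ∫ x in (0 : ℝ)..√(d ^ 2 - z ^ 2), x * p x :=
    intervalIntegral.integral_nonneg (Real.sqrt_nonneg _) fun x hx =>
      mul_nonneg hx.1 (h.pos x hx.1).le
  have := h.c_pos
  have h1 : 0 ≤ 2 * Real.pi * c * ∫ x in (0 : ℝ)..√(d ^ 2 - z ^ 2), x * p x := by positivity
  linarith

theorem integrableOn_radialPdf (h : IsRadial c z p) (a b : ℝ) :
    IntegrableOn (radialPdf c z p) (Set.Ioc a b) := by
  have hc := h.c_pos
  have hz := h.z_nonneg
  refine Measure.integrableOn_of_bounded (M := 2 * Real.pi * c * max b 0) (by simp)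
    h.measurable_radialPdf.aestronglyMeasurable ?_
  refine (ae_restrict_mem measurableSet_Ioc).mono fun r hr => ?_
  rw [Real.norm_of_nonneg (h.radialPdf_nonneg r), radialPdf]
  split_ifs with hr'
  · have h1 := h.le_one _ (Real.sqrt_nonneg (r ^ 2 - z ^ 2))
    have h2 := (h.pos _ (Real.sqrt_nonneg (r ^ 2 - z ^ 2))).le
    have h3 := h.radialVoid_le_one r
    have h4 := (radialVoid_pos (c := c) (z := z) (p := p) r).le
    have h5 : 0 ≤ r := hz.trans hr'
    calc _ ≤ 2 * Real.pi * c * r * 1 * 1 := by gcongr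
      _ ≤ _ := by
        rw [mul_one, mul_one]
        have : r ≤ max b 0 := hr.2.trans (le_max_left _ _)
        gcongr
  · positivity

/-- The density of the contact distance integrates to the decrease of the void probability. -/
theorem lintegral_radialPdf (h : IsRadial c z p) {a b : ℝ} (hab : a ≤ b) :
    ∫⁻ r in Set.Ioc a b, ENNReal.ofReal (radialPdf c z p r) =
      ENNReal.ofReal (radialVoid c z p (max a 0)) -
        ENNReal.ofReal (radialVoid c z p (max b 0)) := by
  have hz := h.z_nonneg
  -- `radialVoid` depends on `d ^ 2`, so negative endpoints must be clipped at `0`. Clipping at `z`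
  -- gives the same value, since the void probability is `1` on `[0, z]`.
  have hclip : ∀ d, radialVoid c z p (max d 0) = radialVoid c z p (max d z) := fun d => by
    rcases le_total d z with hd | hd
    · rw [max_eq_right hd, radialVoid_of_le (le_max_right _ _) (max_le hd hz),
        radialVoid_of_le hz le_rfl]
    · rw [max_eq_left hd, max_eq_left (hz.trans hd)]
  have hab' : max a z ≤ max b z := max_le_max_right _ hab
  rw [hclip, hclip, ← ENNReal.ofReal_sub _ (radialVoid_pos _).le,
    ← h.integral_radialPdf (le_max_right _ _) hab', intervalIntegral.integral_of_le hab',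
    ofReal_integral_eq_lintegral_ofReal (h.integrableOn_radialPdf _ _)
      (ae_of_all _ h.radialPdf_nonneg), ← lintegral_indicator measurableSet_Ioc,
    ← lintegral_indicator measurableSet_Ioc]
  refine lintegral_congr_ae ?_
  -- The two integrands can differ only at `r = z`, where the density need not vanish but the
  -- clipped interval is open.
  filter_upwards [(by simp [ae_iff] : ∀ᵐ r : ℝ, r ≠ z)] with r hr
  rcases lt_or_gt_of_ne hr with hlt | hgt
  · have : radialPdf c z p r = 0 := by simp [radialPdf, hlt.not_ge]
    simp [Set.indicator, this]
  · simp only [Set.indicator, Set.mem_Ioc, max_lt_iff, le_max_iff, hgt, hgt.not_ge, and_true,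
      or_false]

end IsRadial

end UAVHetNet

namespace UAVHetNet

/-! ### Contact distances of radial Poisson processes -/

section Poisson

variable {Ω E : Type*} {Φ : Ω → Set E}

theorem count_eq_zero_iff {B : Set E} {ω : Ω} : count Φ B ω = 0 ↔ ∀ x ∈ Φ ω, x ∉ B := by
  rw [count, Set.encard_eq_zero, Set.eq_empty_iff_forall_notMem]
  simp

variable [MeasurableSpace E]

theorem measurable_sigmaOf_count {B : Set E} (hB : MeasurableSet B) :
    Measurable[sigmaOf Φ] (count Φ B) := by
  rw [measurable_iff_comap_le]
  exact le_iSup₂_of_le B hB le_rfl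

variable [MeasurableSpace Ω] {μ : Measure Ω} {Λ : Measure E}

theorem IsPoissonProcess.measure_count_eq_zero (hΦ : IsPoissonProcess μ Λ Φ) {B : Set E}
    (hB : MeasurableSet B) (hΛ : Λ B ≠ ∞) :
    μ {ω | count Φ B ω = 0} = ENNReal.ofReal (Real.exp (-(Λ B).toReal)) := by
  have h := congrArg (fun ν => ν {0}) (hΦ.law_count B hB hΛ)
  rw [Measure.map_apply (hΦ.measurable_count B hB) (MeasurableSet.singleton _),
    Measure.map_apply (measurable_of_countable _) (MeasurableSet.singleton _)] at h
  have h0 : (Nat.cast : ℕ → ℕ∞) ⁻¹' {0} = {0} := by ext; simp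
  rw [h0, poissonMeasure_singleton] at h
  simpa [Set.preimage, ENNReal.toReal] using h

theorem IsPoissonProcess.sigmaOf_le (hΦ : IsPoissonProcess μ Λ Φ) :
    sigmaOf Φ ≤ ‹MeasurableSpace Ω› :=
  iSup₂_le fun B hB => (hΦ.measurable_count B hB).comap_le

end Poisson

/-- An infimum is at least `a` iff no term is below `a`, so the nonstrict comparison is a counting
event even when the infimum is not attained. -/
theorem le_minDist_iff {Ω : Type*} {Φ : Ω → Set Plane} {z : ℝ} {a : ℝ≥0∞} {ω : Ω} :
    a ≤ minDist z (Φ ω) ↔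
      count Φ {x : Plane | ENNReal.ofReal (√(‖x‖ ^ 2 + z ^ 2)) < a} ω = 0 := by
  rw [count_eq_zero_iff, minDist]
  simp

theorem measurableSet_dist_lt (z : ℝ) (a : ℝ≥0∞) :
    MeasurableSet {x : Plane | ENNReal.ofReal (√(‖x‖ ^ 2 + z ^ 2)) < a} :=
  measurableSet_lt (by fun_prop) measurable_const

theorem setOf_dist_lt (z : ℝ) {d : ℝ} (hd : 0 ≤ d) :
    {x : Plane | ENNReal.ofReal (√(‖x‖ ^ 2 + z ^ 2)) < ENNReal.ofReal d} =
      Metric.ball 0 (√(d ^ 2 - z ^ 2)) := by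
  ext x
  simp only [Set.mem_ofPred_eq, mem_ball_zero_iff]
  rw [ENNReal.ofReal_lt_ofReal_iff_of_nonneg (Real.sqrt_nonneg _), Real.lt_sqrt (norm_nonneg _)]
  rcases hd.eq_or_lt with rfl | hd'
  · constructor
    · intro h; exact absurd h (Real.sqrt_nonneg _).not_gt
    · intro h; nlinarith [sq_nonneg ‖x‖, sq_nonneg z]
  · rw [Real.sqrt_lt' hd']
    constructor <;> intro h <;> linarith

/-- Measurability with respect to the σ-algebra of the process itself is what transfers independence
from the processes to the distances. -/
theorem measurable_sigmaOf_minDist {Ω : Type*} (Φ : Ω → Set Plane) (z : ℝ) :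
    Measurable[sigmaOf Φ] fun ω => minDist z (Φ ω) := by
  let _ := sigmaOf Φ
  refine measurable_of_Ici fun a => ?_
  have : (fun ω => minDist z (Φ ω)) ⁻¹' Set.Ici a =
      count Φ {x : Plane | ENNReal.ofReal (√(‖x‖ ^ 2 + z ^ 2)) < a} ⁻¹' {0} := by
    ext ω; exact le_minDist_iff
  rw [this]
  exact measurable_sigmaOf_count (measurableSet_dist_lt z a) (MeasurableSet.singleton _)

/-- The intensity measure with density `c p(‖x‖)`. -/
noncomputable def radialIntensity (c : ℝ) (p : ℝ → ℝ) : Measure Plane :=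
  volume.withDensity fun x => ENNReal.ofReal (c * p ‖x‖)

namespace IsRadial

variable {c z : ℝ} {p : ℝ → ℝ}

/-- Polar coordinates: the factor `2 * π` is the dimension times the area of the unit disc. -/
theorem radialIntensity_ball (h : IsRadial c z p) {ρ : ℝ} (hρ : 0 ≤ ρ) :
    radialIntensity c p (Metric.ball 0 ρ) =
      ENNReal.ofReal (2 * Real.pi * c * ∫ x in (0 : ℝ)..ρ, x * p x) := by
  have hm := h.measurable
  have hc := h.c_pos
  have hint : IntegrableOn (fun x : Plane => c * p ‖x‖) (Metric.ball 0 ρ) := by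
    refine Measure.integrableOn_of_bounded (M := c) measure_ball_lt_top.ne
      (by fun_prop : Measurable fun x : Plane => c * p ‖x‖).aestronglyMeasurable (ae_of_all _ fun x => ?_)
    rw [Real.norm_eq_abs, abs_mul, abs_of_pos hc]
    exact mul_le_of_le_one_right hc.le (h.abs_le (norm_nonneg x))
  rw [radialIntensity, withDensity_apply _ measurableSet_ball,
    ← ofReal_integral_eq_lintegral_ofReal hint
      (ae_of_all _ fun x => mul_nonneg hc.le (h.pos _ (norm_nonneg x)).le),
    ← integral_indicator measurableSet_ball]
  congr 1
  have heq : (Metric.ball (0 : Plane) ρ).indicator (fun x => c * p ‖x‖) =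
      fun x : Plane => (Set.Iio ρ).indicator (fun y => c * p y) ‖x‖ := by
    funext x; simp [Set.indicator]
  have hvol : (volume : Measure Plane).real (Metric.ball 0 1) = Real.pi := by
    simp [Measure.real, Real.pi_pos.le]
  rw [heq, integral_fun_norm_addHaar volume, hvol]
  simp only [finrank_euclideanSpace, Fintype.card_fin, nsmul_eq_mul, smul_eq_mul]
  have heq2 : (fun y : ℝ => y ^ (2 - 1) * (Set.Iio ρ).indicator (fun y => c * p y) y) =
      (Set.Iio ρ).indicator fun y => c * (y * p y) := by
    funext y; simp only [Set.indicator]; split_ifs <;> ring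
  rw [heq2, setIntegral_indicator measurableSet_Iio, Set.Ioi_inter_Iio, integral_const_mul,
    intervalIntegral.integral_of_le hρ, integral_Ioc_eq_integral_Ioo]
  push_cast
  ring

end IsRadial

section Contact

variable {Ω : Type*} [MeasurableSpace Ω] {μ : Measure Ω} {c z : ℝ} {p : ℝ → ℝ} {Φ : Ω → Set Plane}

theorem IsPoissonProcess.measurable_minDist {Λ : Measure Plane} (hΦ : IsPoissonProcess μ Λ Φ)
    (z : ℝ) : Measurable fun ω => minDist z (Φ ω) :=
  (measurable_sigmaOf_minDist Φ z).mono hΦ.sigmaOf_le le_rfl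

theorem IsPoissonProcess.measure_le_minDist (hΦ : IsPoissonProcess μ (radialIntensity c p) Φ)
    (h : IsRadial c z p) {d : ℝ} (hd : 0 ≤ d) :
    μ {ω | ENNReal.ofReal d ≤ minDist z (Φ ω)} = ENNReal.ofReal (radialVoid c z p d) := by
  simp only [le_minDist_iff, setOf_dist_lt z hd]
  have hΛ := h.radialIntensity_ball (Real.sqrt_nonneg (d ^ 2 - z ^ 2))
  have hc := h.c_pos
  have hint : 0 ≤ ∫ x in (0 : ℝ)..√(d ^ 2 - z ^ 2), x * p x :=
    intervalIntegral.integral_nonneg (Real.sqrt_nonneg _) fun x hx =>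
      mul_nonneg hx.1 (h.pos x hx.1).le
  rw [hΦ.measure_count_eq_zero measurableSet_ball (by rw [hΛ]; exact ENNReal.ofReal_ne_top), hΛ,
    ENNReal.toReal_ofReal (by positivity), radialVoid]
  congr 2; ring

/-- The strict event contains the nonstrict events at every `e > d`. Letting `e` decrease to `d`,
continuity of the void probability shows that equality has probability zero. -/
theorem IsPoissonProcess.measure_lt_minDist [IsFiniteMeasure μ]
    (hΦ : IsPoissonProcess μ (radialIntensity c p) Φ)
    (h : IsRadial c z p) {d : ℝ} (hd : 0 ≤ d) :
    μ {ω | ENNReal.ofReal d < minDist z (Φ ω)} = ENNReal.ofReal (radialVoid c z p d) := by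
  refine le_antisymm ?_ ?_
  · rw [← hΦ.measure_le_minDist h hd]
    exact measure_mono fun ω hω => (Set.mem_ofPred_eq ▸ hω : _ < _).le
  · have hcont : Filter.Tendsto (fun e => ENNReal.ofReal (radialVoid c z p e))
        (nhdsWithin d (Set.Ioi d)) (nhds (ENNReal.ofReal (radialVoid c z p d))) :=
      ((ENNReal.continuous_ofReal.comp h.continuous_radialVoid).tendsto d).mono_left
        nhdsWithin_le_nhds
    refine le_of_tendsto hcont ?_
    filter_upwards [self_mem_nhdsWithin] with e he
    rw [← hΦ.measure_le_minDist h (hd.trans he.le)]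
    exact measure_mono fun ω hω =>
      ((ENNReal.ofReal_lt_ofReal_iff (hd.trans_lt he)).2 he).trans_le hω

/-- The finite part of the contact distance has density `radialPdf`. -/
theorem IsPoissonProcess.map_minDist [IsFiniteMeasure μ]
    (hΦ : IsPoissonProcess μ (radialIntensity c p) Φ) (h : IsRadial c z p) :
    (μ.restrict {ω | minDist z (Φ ω) ≠ ∞}).map (fun ω => (minDist z (Φ ω)).toReal) =
      volume.withDensity fun r => ENNReal.ofReal (radialPdf c z p r) := by
  have hX := hΦ.measurable_minDist z
  refine Measure.ext_of_Ico _ _ fun a b hab => ?_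
  have hle : ∀ d : ℝ, μ {ω | ENNReal.ofReal d ≤ minDist z (Φ ω)} =
      ENNReal.ofReal (radialVoid c z p (max d 0)) := fun d => by
    rw [← hΦ.measure_le_minDist h (le_max_right _ _)]
    rcases le_total d 0 with hd | hd
    · simp [hd, ENNReal.ofReal_of_nonpos]
    · rw [max_eq_left hd]
  have hsub : {ω | ENNReal.ofReal b ≤ minDist z (Φ ω)} ⊆
      {ω | ENNReal.ofReal a ≤ minDist z (Φ ω)} :=
    fun ω hω => (ENNReal.ofReal_le_ofReal hab.le).trans hω
  rw [withDensity_apply _ measurableSet_Ico, setLIntegral_congr Ico_ae_eq_Ioc,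
    h.lintegral_radialPdf hab.le, ← hle a, ← hle b,
    Measure.map_apply (by fun_prop) measurableSet_Ico,
    Measure.restrict_apply ((by fun_prop : Measurable _) measurableSet_Ico),
    ← measure_sdiff hsub (hX measurableSet_Ici).nullMeasurableSet (measure_ne_top _ _)]
  congr 1
  ext ω
  simp only [Set.mem_inter_iff, Set.mem_preimage, Set.mem_Ico, Set.mem_ofPred_eq, Set.mem_sdiff]
  rcases eq_or_ne (minDist z (Φ ω)) ∞ with hω | hω
  · simp [hω]
  · obtain ⟨x, hx, hx'⟩ : ∃ x : ℝ, 0 ≤ x ∧ minDist z (Φ ω) = ENNReal.ofReal x :=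
      ⟨_, ENNReal.toReal_nonneg, (ENNReal.ofReal_toReal hω).symm⟩
    simp [hx', ENNReal.toReal_ofReal hx, ENNReal.ofReal_le_ofReal_iff hx]

end Contact

/-! ### Independent thinning of a contact distance -/

section Independence

variable {Ω β : Type*} [MeasurableSpace Ω] [MeasurableSpace β] {μ : Measure Ω} [IsFiniteMeasure μ]
  {X : Ω → ℝ≥0∞} {W : Ω → β} {f : ℝ → ℝ≥0∞}

/-- Under independence the joint law is a product, so Fubini lets one freeze the first variable at
`r` and take the probability of the section of `E` at `r`. -/
theorem map_toReal_restrict_of_indepFun (hX : Measurable X) (hW : Measurable W)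
    (hind : IndepFun X W μ) (hf : Measurable f)
    (hd : (μ.restrict {ω | X ω ≠ ∞}).map (fun ω => (X ω).toReal) = volume.withDensity f)
    {E : Set (ℝ × β)} (hE : MeasurableSet E) :
    (μ.restrict {ω | X ω ≠ ∞ ∧ ((X ω).toReal, W ω) ∈ E}).map (fun ω => (X ω).toReal) =
      volume.withDensity fun r => f r * μ {ω | (r, W ω) ∈ E} := by
  have hXr : Measurable fun ω => (X ω).toReal := by fun_prop
  have hg : Measurable fun r : ℝ => μ {ω | (r, W ω) ∈ E} := by
    have := measurable_measure_prodMk_left (ν := μ.map W) hE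
    convert this using 2 with r
    rw [Measure.map_apply hW (measurable_prodMk_left hE)]; rfl
  ext S hS
  let T : Set (ℝ≥0∞ × β) := {q | q.1 ≠ ∞ ∧ q.1.toReal ∈ S ∧ (q.1.toReal, q.2) ∈ E}
  have hT : MeasurableSet T := by
    refine MeasurableSet.inter ?_ (MeasurableSet.inter ?_ ?_)
    · exact measurable_fst (MeasurableSet.singleton (∞ : ℝ≥0∞)).compl
    · exact (by fun_prop : Measurable fun q : ℝ≥0∞ × β => q.1.toReal) hS
    · exact (by fun_prop : Measurable fun q : ℝ≥0∞ × β => (q.1.toReal, q.2)) hE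
  have hfin : MeasurableSet {ω | X ω ≠ ∞} := hX (MeasurableSet.singleton (∞ : ℝ≥0∞)).compl
  have hTsec : ∀ x : ℝ≥0∞, μ.map W (Prod.mk x ⁻¹' T) =
      {x : ℝ≥0∞ | x ≠ ∞}.indicator
        (fun x => S.indicator (fun r => μ {ω | (r, W ω) ∈ E}) x.toReal) x := fun x => by
    rw [Measure.map_apply hW (measurable_prodMk_left hT)]
    by_cases hx : x ≠ ∞ <;> by_cases hxS : x.toReal ∈ S <;>
      simp [T, Set.preimage, hx, hxS]
  rw [Measure.map_apply hXr hS, Measure.restrict_apply (hXr hS), withDensity_apply _ hS]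
  calc μ ((fun ω => (X ω).toReal) ⁻¹' S ∩ {ω | X ω ≠ ∞ ∧ ((X ω).toReal, W ω) ∈ E})
      = μ.map (fun ω => (X ω, W ω)) T := by
        rw [Measure.map_apply (hX.prodMk hW) hT]
        congr 1; ext ω; simp [T]; tauto
    _ = ∫⁻ x, μ.map W (Prod.mk x ⁻¹' T) ∂(μ.map X) := by
        rw [hind.map_prod_eq_prod_map_map hX.aemeasurable hW.aemeasurable,
          Measure.prod_apply hT]
    _ = ∫⁻ ω in {ω | X ω ≠ ∞},
          S.indicator (fun r => μ {ω | (r, W ω) ∈ E}) (X ω).toReal ∂μ := by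
        rw [lintegral_map (measurable_measure_prodMk_left hT) hX, ← lintegral_indicator hfin]
        simp_rw [hTsec]
        rfl
    _ = ∫⁻ r, S.indicator (fun r => μ {ω | (r, W ω) ∈ E}) r
          ∂((μ.restrict {ω | X ω ≠ ∞}).map fun ω => (X ω).toReal) := by
        rw [lintegral_map (hg.indicator hS) hXr]
    _ = ∫⁻ r in S, f r * μ {ω | (r, W ω) ∈ E} := by
        rw [hd, lintegral_withDensity_eq_lintegral_mul _ hf (hg.indicator hS),
          ← lintegral_indicator hS]
        congr 1; funext r
        by_cases hr : r ∈ S <;> simp [hr]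

theorem map_toReal_restrict_of_indepFun₂ {Y Z : Ω → ℝ≥0∞} (hX : Measurable X) (hY : Measurable Y)
    (hZ : Measurable Z) (hind : IndepFun X (fun ω => (Y ω, Z ω)) μ) (hind' : IndepFun Y Z μ)
    (hf : Measurable f)
    (hd : (μ.restrict {ω | X ω ≠ ∞}).map (fun ω => (X ω).toReal) = volume.withDensity f)
    {A B : Set (ℝ × ℝ≥0∞)} (hA : MeasurableSet A) (hB : MeasurableSet B) :
    (μ.restrict {ω | X ω ≠ ∞ ∧ ((X ω).toReal, Y ω) ∈ A ∧ ((X ω).toReal, Z ω) ∈ B}).map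
        (fun ω => (X ω).toReal) =
      volume.withDensity fun r => f r * (μ {ω | (r, Y ω) ∈ A} * μ {ω | (r, Z ω) ∈ B}) := by
  have hE : MeasurableSet {q : ℝ × ℝ≥0∞ × ℝ≥0∞ | (q.1, q.2.1) ∈ A ∧ (q.1, q.2.2) ∈ B} :=
    ((by fun_prop : Measurable fun q : ℝ × ℝ≥0∞ × ℝ≥0∞ => (q.1, q.2.1)) hA).inter
      ((by fun_prop : Measurable fun q : ℝ × ℝ≥0∞ × ℝ≥0∞ => (q.1, q.2.2)) hB)
  have h := map_toReal_restrict_of_indepFun hX (hY.prodMk hZ) hind hf hd hE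
  simp only [Set.mem_ofPred_eq] at h
  rw [h]
  congr 1; funext r
  congr 1
  exact hind'.measure_inter_preimage_eq_mul _ _ (measurable_prodMk_left hA)
    (measurable_prodMk_left hB)

end Independence

/-! ### Densities under conditioning -/

section Conditioning

variable {Ω : Type*} [MeasurableSpace Ω] {μ : Measure Ω} [IsFiniteMeasure μ] {X : Ω → ℝ}
  {g : ℝ → ℝ} {A B C : Set Ω}

/-- If `B` were null, the density would vanish almost everywhere on `(a, b)`, contradicting its
positivity there. -/
theorem measureReal_pos_of_map_restrict (hBA : B ≤ᵐ[μ] A)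
    (hmap : (μ.restrict B).map X = volume.withDensity fun r => ENNReal.ofReal (g r))
    {a b : ℝ} (hab : a < b) (hg : ∀ r ∈ Set.Ioo a b, 0 < g r) (hgm : Measurable g) :
    0 < μ.real A := by
  refine ENNReal.toReal_pos ?_ (measure_ne_top _ _)
  have hB : μ B ≠ 0 := fun h0 => by
    have h1 := congrArg (fun ν => ν (Set.Ioo a b)) hmap
    simp only [Measure.restrict_eq_zero.2 h0, Measure.map_zero, Measure.coe_zero,
      Pi.zero_apply] at h1
    rw [withDensity_apply _ measurableSet_Ioo, eq_comm,
      setLIntegral_eq_zero_iff measurableSet_Ioo (by fun_prop)] at h1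
    have h2 : volume (Set.Ioo a b) = 0 := by
      refine measure_mono_null (fun r hr => ?_) (ae_iff.1 h1)
      simp only [Set.mem_ofPred_eq, ENNReal.ofReal_eq_zero, not_forall]
      exact ⟨hr, (hg r hr).not_ge⟩
    rw [Real.volume_Ioo, ENNReal.ofReal_eq_zero] at h2
    linarith
  exact fun h0 => hB (le_antisymm ((measure_mono_ae hBA).trans h0.le) bot_le)

/-- The conditional measure is the restriction to `A` scaled by `(μ A)⁻¹`, so the density is scaled
likewise. `B` is an almost sure description of `A ∩ C` whose law is already known. -/
theorem hasDensity_restrict_cond (hX : Measurable X)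
    (hC : MeasurableSet C) (hB : (A ∩ C : Set Ω) =ᵐ[μ] B) (hA0 : 0 < μ.real A)
    (hmap : (μ.restrict B).map X = volume.withDensity fun r => ENNReal.ofReal (g r))
    (hg : Measurable g) (hg0 : ∀ r, 0 ≤ g r) {f : ℝ → ℝ} (hf : ∀ r, f r = g r / μ.real A) :
    HasDensity ((μ[|A]).restrict C) X f := by
  obtain rfl : f = fun r => g r / μ.real A := funext hf
  refine ⟨hX.aemeasurable, fun r => div_nonneg (hg0 r) hA0.le, hg.div_const _, ?_⟩
  have h1 : (μ[|A]).restrict C = (μ A)⁻¹ • μ.restrict B := by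
    rw [ProbabilityTheory.cond, Measure.restrict_smul, Measure.restrict_restrict hC, Set.inter_comm,
      Measure.restrict_congr_set hB]
  have h2 : (μ A)⁻¹ = ENNReal.ofReal (μ.real A)⁻¹ := by
    rw [ENNReal.ofReal_inv_of_pos hA0, ofReal_measureReal]
  rw [h1, Measure.map_smul, hmap, h2, ← withDensity_smul _ (by fun_prop)]
  congr 1; funext r
  rw [Pi.smul_apply, smul_eq_mul, ← ENNReal.ofReal_mul (inv_nonneg.2 hA0.le), inv_mul_eq_div]

theorem hasDensity_cond (hX : Measurable X) (hB : A =ᵐ[μ] B)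
    (hA0 : 0 < μ.real A)
    (hmap : (μ.restrict B).map X = volume.withDensity fun r => ENNReal.ofReal (g r))
    (hg : Measurable g) (hg0 : ∀ r, 0 ≤ g r) {f : ℝ → ℝ} (hf : ∀ r, f r = g r / μ.real A) :
    HasDensity (μ[|A]) X f := by
  have h := hasDensity_restrict_cond hX MeasurableSet.univ (by rwa [Set.inter_univ]) hA0 hmap
    hg hg0 hf
  rwa [Measure.restrict_univ] at h

theorem HasDensity.add {ν : Measure Ω} {f₁ f₂ : ℝ → ℝ} (hX : Measurable X) (hC : MeasurableSet C)
    (h₁ : HasDensity (ν.restrict Cᶜ) X f₁) (h₂ : HasDensity (ν.restrict C) X f₂) :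
    HasDensity ν X fun r => f₁ r + f₂ r := by
  refine ⟨hX.aemeasurable, fun r => add_nonneg (h₁.2.1 r) (h₂.2.1 r), h₁.2.2.1.add h₂.2.2.1, ?_⟩
  have hm₁ := h₁.2.2.1
  rw [← Measure.restrict_compl_add_restrict (μ := ν) hC, Measure.map_add _ _ hX, h₁.2.2.2,
    h₂.2.2.2, ← withDensity_add_left (by fun_prop)]
  congr 1; funext r
  rw [Pi.add_apply, ENNReal.ofReal_add (h₁.2.1 r) (h₂.2.1 r)]

end Conditioning

end UAVHetNet

namespace UAVHetNet

/-! ### Comparison of received powers -/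

/-- The distance at which a station of class `i` is received as strongly as one of class `j` at
distance `r`. -/
noncomputable def equivDist (ηi αi ηj αj r : ℝ) : ℝ := (ηi / ηj) ^ (1 / αi) * r ^ (αj / αi)

section EquivDist

variable {ηi αi ηj αj : ℝ}

theorem equivDist_nonneg (hηi : 0 < ηi) (hηj : 0 < ηj) {r : ℝ} (hr : 0 ≤ r) :
    0 ≤ equivDist ηi αi ηj αj r := by
  unfold equivDist; positivity

theorem measurable_equivDist : Measurable (equivDist ηi αi ηj αj) := by
  unfold equivDist; fun_prop

/-- Exchanging the two classes inverts the map, and the map is increasing on nonnegative distances.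
-/
theorem equivDist_le_iff (hηi : 0 < ηi) (hαi : 0 < αi) (hηj : 0 < ηj) (hαj : 0 < αj) {r s : ℝ}
    (hr : 0 ≤ r) (hs : 0 ≤ s) :
    equivDist ηi αi ηj αj r ≤ s ↔ r ≤ equivDist ηj αj ηi αi s := by
  have hinv : equivDist ηj αj ηi αi (equivDist ηi αi ηj αj r) = r := by
    unfold equivDist
    rw [Real.mul_rpow (by positivity) (by positivity), ← Real.rpow_mul (by positivity),
      ← Real.rpow_mul hr, ← inv_div ηi ηj, Real.inv_rpow (by positivity)]
    have h1 : 1 / αi * (αi / αj) = 1 / αj := by field_simp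
    have h2 : αj / αi * (αi / αj) = 1 := by field_simp
    rw [h1, h2, Real.rpow_one, inv_mul_cancel_left₀ (by positivity)]
  have hmono : ∀ {x y : ℝ}, 0 ≤ x → 0 ≤ y →
      (equivDist ηj αj ηi αi x ≤ equivDist ηj αj ηi αi y ↔ x ≤ y) := fun hx hy => by
    unfold equivDist
    rw [mul_le_mul_iff_right₀ (by positivity), Real.rpow_le_rpow_iff hx hy (by positivity)]
  rw [← hmono (equivDist_nonneg hηi hηj hr) hs, hinv]

theorem rpow_neg_lt_rpow_neg_iff (hηi : 0 < ηi) (hαi : 0 < αi) (hηj : 0 < ηj) (hαj : 0 < αj)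
    {r : ℝ} (hr : 0 ≤ r) (y : ℝ≥0∞) :
    ENNReal.ofReal ηi * y ^ (-αi) < ENNReal.ofReal ηj * ENNReal.ofReal r ^ (-αj) ↔
      ENNReal.ofReal (equivDist ηi αi ηj αj r) < y := by
  have hi : ENNReal.ofReal ηi ≠ 0 := by simpa using hηi
  have hj : ENNReal.ofReal ηj ≠ 0 := by simpa using hηj
  -- The degenerate distances come first: power `0` at distance `∞` and power `∞` at distance `0`.
  rcases eq_or_ne y ∞ with rfl | hy
  · rw [ENNReal.top_rpow_of_neg (by linarith), mul_zero]
    refine iff_of_true (ENNReal.mul_pos hj ?_) ENNReal.ofReal_lt_top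
    rw [ENNReal.rpow_neg]
    exact ENNReal.inv_ne_zero.2 (ENNReal.rpow_ne_top_of_nonneg hαj.le ENNReal.ofReal_ne_top)
  obtain ⟨s, hs, rfl⟩ : ∃ s : ℝ, 0 ≤ s ∧ y = ENNReal.ofReal s :=
    ⟨_, ENNReal.toReal_nonneg, (ENNReal.ofReal_toReal hy).symm⟩
  rcases hs.eq_or_lt with rfl | hs'
  · rw [ENNReal.ofReal_zero, ENNReal.zero_rpow_of_neg (by linarith), ENNReal.mul_top hi]
    simp
  rcases hr.eq_or_lt with rfl | hr'
  · rw [ENNReal.ofReal_zero, ENNReal.zero_rpow_of_neg (by linarith), ENNReal.mul_top hj,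
      equivDist, Real.zero_rpow (by positivity), mul_zero, ENNReal.ofReal_zero]
    refine iff_of_true (ENNReal.mul_lt_top ENNReal.ofReal_lt_top ?_) (by simpa using hs')
    rw [ENNReal.ofReal_rpow_of_pos hs']
    exact ENNReal.ofReal_lt_top
  rw [ENNReal.ofReal_rpow_of_pos hs', ENNReal.ofReal_rpow_of_pos hr',
    ← ENNReal.ofReal_mul hηi.le, ← ENNReal.ofReal_mul hηj.le,
    ENNReal.ofReal_lt_ofReal_iff (by positivity), ENNReal.ofReal_lt_ofReal_iff hs',
    Real.rpow_neg hs, Real.rpow_neg hr, ← div_eq_mul_inv, ← div_eq_mul_inv,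
    div_lt_div_iff₀ (by positivity) (by positivity)]
  have hpow : equivDist ηi αi ηj αj r ^ αi = ηi / ηj * r ^ αj := by
    unfold equivDist
    rw [Real.mul_rpow (by positivity) (by positivity), ← Real.rpow_mul (by positivity),
      ← Real.rpow_mul hr, one_div_mul_cancel hαi.ne', div_mul_cancel₀ _ hαi.ne', Real.rpow_one]
  rw [← Real.rpow_lt_rpow_iff (equivDist_nonneg hηi hηj hr) hs hαi, hpow, div_mul_eq_mul_div,
    div_lt_iff₀ hηj, mul_comm (s ^ αi)]

/-- An infinite `x` gives power `0`, which exceeds nothing; this is the origin of the finiteness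
condition in every association event. -/
theorem lt_mul_rpow_neg_iff (hηi : 0 < ηi) (hαi : 0 < αi) (hηj : 0 < ηj) (hαj : 0 < αj)
    (x y : ℝ≥0∞) :
    ENNReal.ofReal ηi * y ^ (-αi) < ENNReal.ofReal ηj * x ^ (-αj) ↔
      x ≠ ∞ ∧ ENNReal.ofReal (equivDist ηi αi ηj αj x.toReal) < y := by
  rcases eq_or_ne x ∞ with rfl | hx
  · rw [ENNReal.top_rpow_of_neg (by linarith), mul_zero]; simp
  · have h := rpow_neg_lt_rpow_neg_iff hηi hαi hηj hαj (ENNReal.toReal_nonneg (a := x)) y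
    rw [ENNReal.ofReal_toReal hx] at h
    rw [h]; simp [hx]

end EquivDist

/-! ### The three tiers as radial models -/

namespace Network

variable (n : Network)

theorem ηT_pos : 0 < n.ηT := mul_pos (mul_pos n.GM_pos n.PT_pos) n.CT_pos

theorem ηL_pos : 0 < n.ηL := mul_pos (mul_pos n.an_pos n.PA_pos) n.CL_pos

theorem ηN_pos : 0 < n.ηN := mul_pos (mul_pos n.an_pos n.PA_pos) n.CN_pos

theorem isRadialT : IsRadial n.lamT 0 1 :=
  ⟨n.lamT_pos, le_rfl, measurable_const, fun _ _ => one_pos, fun _ _ => le_rfl⟩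

theorem isRadialL {PL : ℝ → ℝ} (hPL : IsLoSProbability PL) : IsRadial n.lamA n.h PL :=
  ⟨n.lamA_pos, n.h_pos.le, hPL.measurable, hPL.pos, fun x hx => (hPL.lt_one x hx).le⟩

theorem isRadialN {PL : ℝ → ℝ} (hPL : IsLoSProbability PL) :
    IsRadial n.lamA n.h fun x => 1 - PL x :=
  ⟨n.lamA_pos, n.h_pos.le, measurable_const.sub hPL.measurable,
    fun x hx => sub_pos.2 (hPL.lt_one x hx), fun x hx => sub_le_self _ (hPL.pos x hx).le⟩

theorem intensityT_eq : n.intensityT = radialIntensity n.lamT 1 := by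
  simp [intensityT, radialIntensity]

theorem voidT_eq {d : ℝ} (hd : 0 ≤ d) :
    radialVoid n.lamT 0 1 d = Real.exp (-Real.pi * n.lamT * d ^ 2) := by
  have h : √(d ^ 2 - 0 ^ 2) = d := by simp [Real.sqrt_sq hd]
  rw [radialVoid, h]
  simp only [Pi.one_apply, mul_one, integral_id]
  congr 1; ring

theorem one_sub_QT : 1 - n.QT = radialVoid n.lamT 0 1 n.RB := by
  rw [n.voidT_eq n.RB_pos.le, QT]; ring

theorem pdfT_eq (r : ℝ) : n.pdfT r = (Set.Iic n.RB).indicator (radialPdf n.lamT 0 1) r := by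
  simp only [pdfT, radialPdf, Set.indicator, Set.mem_Iic]
  by_cases h0 : 0 ≤ r <;> by_cases hr : r ≤ n.RB <;> simp [h0, hr, n.voidT_eq]

end Network

/-! ### Measurability and independence of the nearest-station distances -/

section Measurability

variable {Ω : Type*} [MeasurableSpace Ω] {μ : Measure Ω} {n : Network} {PL : ℝ → ℝ}
  {Φ : BaseStations Ω}

namespace IsHetNet

variable (hΦ : IsHetNet μ n PL Φ)
include hΦ

theorem measurable_distT : Measurable (distT Φ) := hΦ.tbs.measurable_minDist 0

theorem measurable_distL : Measurable (distL n Φ) := hΦ.los.measurable_minDist n.h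

theorem measurable_distN : Measurable (distN n Φ) := hΦ.nlos.measurable_minDist n.h

theorem tbs_radial : IsPoissonProcess μ (radialIntensity n.lamT 1) Φ.tbs := by
  rw [← n.intensityT_eq]; exact hΦ.tbs

theorem los_radial : IsPoissonProcess μ (radialIntensity n.lamA PL) Φ.los := hΦ.los

theorem nlos_radial : IsPoissonProcess μ (radialIntensity n.lamA fun x => 1 - PL x) Φ.nlos :=
  hΦ.nlos

theorem iIndepFun_dist : iIndepFun ![distT Φ, distL n Φ, distN n Φ] μ := by
  refine iIndep_of_iIndep_of_le hΦ.indep fun i => ?_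
  fin_cases i
  · exact (measurable_sigmaOf_minDist Φ.tbs 0).comap_le
  · exact (measurable_sigmaOf_minDist Φ.los n.h).comap_le
  · exact (measurable_sigmaOf_minDist Φ.nlos n.h).comap_le

theorem measurable_dist : ∀ i, Measurable (![distT Φ, distL n Φ, distN n Φ] i) := by
  intro i
  fin_cases i
  exacts [hΦ.measurable_distT, hΦ.measurable_distL, hΦ.measurable_distN]

theorem measurableSet_tbsInBall : MeasurableSet (tbsInBall n Φ) := by
  have : tbsInBall n Φ = count Φ.tbs (Metric.closedBall 0 n.RB) ⁻¹' {0}ᶜ := by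
    ext ω
    simp [tbsInBall, count, Set.nonempty_iff_ne_empty]
  rw [this]
  exact hΦ.tbs.measurable_count _ Metric.isClosed_closedBall.measurableSet
    (MeasurableSet.singleton _).compl

end IsHetNet

end Measurability

end UAVHetNet

namespace UAVHetNet

/-! ### Association events -/

section Events

variable {Ω : Type*} {n : Network} {Φ : BaseStations Ω} {ω : Ω}

theorem powL_lt_powN_iff : powL n Φ ω < powN n Φ ω ↔
    distN n Φ ω ≠ ∞ ∧ ENNReal.ofReal (n.τLN (distN n Φ ω).toReal) < distL n Φ ω :=
  lt_mul_rpow_neg_iff n.ηL_pos n.αL_pos n.ηN_pos n.αN_pos _ _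

theorem powN_lt_powL_iff : powN n Φ ω < powL n Φ ω ↔
    distL n Φ ω ≠ ∞ ∧ ENNReal.ofReal (n.τNL (distL n Φ ω).toReal) < distN n Φ ω :=
  lt_mul_rpow_neg_iff n.ηN_pos n.αN_pos n.ηL_pos n.αL_pos _ _

theorem powT_of_lt (h : ENNReal.ofReal n.RB < distT Φ ω) : powT n Φ ω = 0 :=
  if_neg h.not_ge

theorem powT_of_le (h : distT Φ ω ≤ ENNReal.ofReal n.RB) :
    powT n Φ ω = ENNReal.ofReal n.ηT * distT Φ ω ^ (-n.αT) :=
  if_pos h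

theorem mem_assocN_iff_of_lt (h : ENNReal.ofReal n.RB < distT Φ ω) : ω ∈ assocN n Φ ↔
    distN n Φ ω ≠ ∞ ∧ ENNReal.ofReal (n.τLN (distN n Φ ω).toReal) < distL n Φ ω := by
  rw [← powL_lt_powN_iff]
  change powT n Φ ω < powN n Φ ω ∧ powL n Φ ω < powN n Φ ω ↔ _
  rw [powT_of_lt h]
  -- With zero TBS power, beating the LoS power already forces a positive NLoS power.
  exact and_iff_right_of_imp pos_of_gt

theorem mem_assocL_iff_of_lt (h : ENNReal.ofReal n.RB < distT Φ ω) : ω ∈ assocL n Φ ↔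
    distL n Φ ω ≠ ∞ ∧ ENNReal.ofReal (n.τNL (distL n Φ ω).toReal) < distN n Φ ω := by
  rw [← powN_lt_powL_iff]
  change powT n Φ ω < powL n Φ ω ∧ powN n Φ ω < powL n Φ ω ↔ _
  rw [powT_of_lt h]
  exact and_iff_right_of_imp pos_of_gt

theorem mem_assocL_iff_of_le (h : distT Φ ω ≤ ENNReal.ofReal n.RB) : ω ∈ assocL n Φ ↔
    distL n Φ ω ≠ ∞ ∧ ENNReal.ofReal (n.τNL (distL n Φ ω).toReal) < distN n Φ ω ∧
      ENNReal.ofReal (n.τTL (distL n Φ ω).toReal) < distT Φ ω := by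
  have hT : powT n Φ ω < powL n Φ ω ↔ distL n Φ ω ≠ ∞ ∧
      ENNReal.ofReal (n.τTL (distL n Φ ω).toReal) < distT Φ ω := by
    rw [powT_of_le h]
    exact lt_mul_rpow_neg_iff n.ηT_pos n.αT_pos n.ηL_pos n.αL_pos _ _
  change powT n Φ ω < powL n Φ ω ∧ powN n Φ ω < powL n Φ ω ↔ _
  rw [hT, powN_lt_powL_iff]
  tauto

theorem mem_assocT_iff : ω ∈ assocT n Φ ↔
    distT Φ ω ≠ ∞ ∧ ENNReal.ofReal (n.τLT (distT Φ ω).toReal) < distL n Φ ω ∧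
      ENNReal.ofReal (equivDist n.ηN n.αN n.ηT n.αT (distT Φ ω).toReal) < distN n Φ ω ∧
        (distT Φ ω).toReal ≤ n.RB := by
  change powL n Φ ω < powT n Φ ω ∧ powN n Φ ω < powT n Φ ω ↔ _
  by_cases h : distT Φ ω ≤ ENNReal.ofReal n.RB
  · have hL : powL n Φ ω < ENNReal.ofReal n.ηT * distT Φ ω ^ (-n.αT) ↔ distT Φ ω ≠ ∞ ∧
        ENNReal.ofReal (n.τLT (distT Φ ω).toReal) < distL n Φ ω :=
      lt_mul_rpow_neg_iff n.ηL_pos n.αL_pos n.ηT_pos n.αT_pos _ _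
    have hN : powN n Φ ω < ENNReal.ofReal n.ηT * distT Φ ω ^ (-n.αT) ↔ distT Φ ω ≠ ∞ ∧
        ENNReal.ofReal (equivDist n.ηN n.αN n.ηT n.αT (distT Φ ω).toReal) < distN n Φ ω :=
      lt_mul_rpow_neg_iff n.ηN_pos n.αN_pos n.ηT_pos n.αT_pos _ _
    have hR : (distT Φ ω).toReal ≤ n.RB := ENNReal.toReal_le_of_le_ofReal n.RB_pos.le h
    rw [powT_of_le h, hL, hN]
    tauto
  · rw [powT_of_lt (not_le.1 h)]
    refine iff_of_false (fun h0 => not_lt_bot h0.1) fun h0 => h ?_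
    exact (ENNReal.le_ofReal_iff_toReal_le h0.1 n.RB_pos.le).2 h0.2.2.2

theorem assocT_eq : assocT n Φ = {ω | distT Φ ω ≠ ∞ ∧
    ((distT Φ ω).toReal, distL n Φ ω) ∈ {q : ℝ × ℝ≥0∞ | ENNReal.ofReal (n.τLT q.1) < q.2} ∧
    ((distT Φ ω).toReal, distN n Φ ω) ∈ {q : ℝ × ℝ≥0∞ |
      ENNReal.ofReal (equivDist n.ηN n.αN n.ηT n.αT q.1) < q.2 ∧ q.1 ≤ n.RB}} := by
  ext ω; exact mem_assocT_iff

end Events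

namespace IsHetNet

variable {Ω : Type*} [MeasurableSpace Ω] {μ : Measure Ω} [IsProbabilityMeasure μ] {n : Network}
  {PL : ℝ → ℝ} {Φ : BaseStations Ω}

/-- The infimum may equal `R_B` without being attained, so the equivalence can fail there; that
event is null because the strict and nonstrict void probabilities agree. -/
theorem ae_mem_tbsInBall_iff (hΦ : IsHetNet μ n PL Φ) :
    ∀ᵐ ω ∂μ, ω ∈ tbsInBall n Φ ↔ distT Φ ω ≤ ENNReal.ofReal n.RB := by
  have hm := hΦ.measurable_distT
  have hsub : {ω | ENNReal.ofReal n.RB < distT Φ ω} ⊆ {ω | ENNReal.ofReal n.RB ≤ distT Φ ω} :=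
    fun ω hω => le_of_lt (Set.mem_ofPred_eq ▸ hω : _ < _)
  have heq : {ω | ENNReal.ofReal n.RB < distT Φ ω} =ᵐ[μ] {ω | ENNReal.ofReal n.RB ≤ distT Φ ω} := by
    refine ae_eq_of_subset_of_measure_ge hsub (le_of_eq ?_)
      (measurableSet_lt measurable_const hm).nullMeasurableSet (measure_ne_top _ _)
    exact (hΦ.tbs_radial.measure_le_minDist n.isRadialT n.RB_pos.le).trans
      (hΦ.tbs_radial.measure_lt_minDist n.isRadialT n.RB_pos.le).symm
  filter_upwards [heq.mem_iff] with ω hω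
  have hdist : ∀ x : Plane, √(‖x‖ ^ 2 + 0 ^ 2) = ‖x‖ := fun x => by simp
  constructor
  · rintro ⟨x, hx, hx'⟩
    refine (iInf₂_le x hx).trans ?_
    rw [hdist]
    exact ENNReal.ofReal_le_ofReal (by simpa using hx')
  · intro h
    by_contra hne
    refine absurd (hω.2 ?_) h.not_gt
    refine le_iInf₂ fun x hx => ?_
    rw [hdist]
    refine ENNReal.ofReal_le_ofReal (le_of_lt (not_le.1 fun hle => hne ⟨x, hx, ?_⟩))
    simpa using hle

theorem assocN_ae_eq (hΦ : IsHetNet μ n PL Φ)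
    (h : ∀ᵐ ω ∂μ, ω ∈ tbsInBall n Φ → ω ∉ assocN n Φ) :
    assocN n Φ =ᵐ[μ] {ω | distN n Φ ω ≠ ∞ ∧
      ((distN n Φ ω).toReal, distL n Φ ω) ∈ {q : ℝ × ℝ≥0∞ | ENNReal.ofReal (n.τLN q.1) < q.2} ∧
      ((distN n Φ ω).toReal, distT Φ ω) ∈ {q : ℝ × ℝ≥0∞ | ENNReal.ofReal n.RB < q.2}} := by
  refine Filter.eventuallyEq_set.2 ?_
  filter_upwards [h, hΦ.ae_mem_tbsInBall_iff] with ω h1 h2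
  rw [h2] at h1
  by_cases hT : distT Φ ω ≤ ENNReal.ofReal n.RB
  · exact iff_of_false (h1 hT) fun h3 => hT.not_gt h3.2.2
  · rw [mem_assocN_iff_of_lt (not_le.1 hT)]
    simp [not_le.1 hT]

theorem assocL_inter_compl_ae_eq (hΦ : IsHetNet μ n PL Φ) :
    (assocL n Φ ∩ (tbsInBall n Φ)ᶜ : Set Ω) =ᵐ[μ] {ω | distL n Φ ω ≠ ∞ ∧
      ((distL n Φ ω).toReal, distN n Φ ω) ∈ {q : ℝ × ℝ≥0∞ | ENNReal.ofReal (n.τNL q.1) < q.2} ∧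
      ((distL n Φ ω).toReal, distT Φ ω) ∈ {q : ℝ × ℝ≥0∞ | ENNReal.ofReal n.RB < q.2}} := by
  refine Filter.eventuallyEq_set.2 ?_
  filter_upwards [hΦ.ae_mem_tbsInBall_iff] with ω h2
  simp only [Set.mem_inter_iff, Set.mem_compl_iff, h2, not_le]
  rw [← and_assoc]
  exact and_congr_left fun hT => mem_assocL_iff_of_lt hT

theorem assocL_inter_ae_eq (hΦ : IsHetNet μ n PL Φ) :
    (assocL n Φ ∩ tbsInBall n Φ : Set Ω) =ᵐ[μ] {ω | distL n Φ ω ≠ ∞ ∧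
      ((distL n Φ ω).toReal, distN n Φ ω) ∈ {q : ℝ × ℝ≥0∞ | ENNReal.ofReal (n.τNL q.1) < q.2} ∧
      ((distL n Φ ω).toReal, distT Φ ω) ∈
        {q : ℝ × ℝ≥0∞ | ENNReal.ofReal (n.τTL q.1) < q.2 ∧ q.2 ≤ ENNReal.ofReal n.RB}} := by
  refine Filter.eventuallyEq_set.2 ?_
  filter_upwards [hΦ.ae_mem_tbsInBall_iff] with ω h2
  simp only [Set.mem_inter_iff, h2]
  rw [← and_assoc, ← and_assoc]
  refine and_congr_left fun hT => ?_
  rw [mem_assocL_iff_of_le hT, and_assoc]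

/-! ### Laws of the serving distances on the association events -/

theorem measure_lt_distL (hΦ : IsHetNet μ n PL Φ) (hPL : IsLoSProbability PL) {d : ℝ}
    (hd : 0 ≤ d) : μ {ω | ENNReal.ofReal d < distL n Φ ω} = ENNReal.ofReal (n.voidL PL d) :=
  hΦ.los_radial.measure_lt_minDist (n.isRadialL hPL) hd

theorem measure_lt_distN (hΦ : IsHetNet μ n PL Φ) (hPL : IsLoSProbability PL) {d : ℝ}
    (hd : 0 ≤ d) : μ {ω | ENNReal.ofReal d < distN n Φ ω} = ENNReal.ofReal (n.voidN PL d) :=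
  hΦ.nlos_radial.measure_lt_minDist (n.isRadialN hPL) hd

theorem measure_lt_distT (hΦ : IsHetNet μ n PL Φ) {d : ℝ} (hd : 0 ≤ d) :
    μ {ω | ENNReal.ofReal d < distT Φ ω} =
      ENNReal.ofReal (Real.exp (-Real.pi * n.lamT * d ^ 2)) := by
  rw [← n.voidT_eq hd]
  exact hΦ.tbs_radial.measure_lt_minDist n.isRadialT hd

theorem measure_RB_lt_distT (hΦ : IsHetNet μ n PL Φ) :
    μ {ω | ENNReal.ofReal n.RB < distT Φ ω} = ENNReal.ofReal (1 - n.QT) := by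
  rw [hΦ.measure_lt_distT n.RB_pos.le, n.one_sub_QT, n.voidT_eq n.RB_pos.le]

theorem measure_lt_distT_le (hΦ : IsHetNet μ n PL Φ) {d : ℝ} (hd : 0 ≤ d) :
    μ {ω | ENNReal.ofReal d < distT Φ ω ∧ distT Φ ω ≤ ENNReal.ofReal n.RB} =
      ENNReal.ofReal (Real.exp (-Real.pi * n.lamT * d ^ 2) - (1 - n.QT)) := by
  have hQ : 0 ≤ 1 - n.QT := n.one_sub_QT ▸ (radialVoid_pos _).le
  have hm := hΦ.measurable_distT
  rw [ENNReal.ofReal_sub _ hQ, ← hΦ.measure_lt_distT hd, ← hΦ.measure_RB_lt_distT]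
  rcases le_total d n.RB with h | h
  · have hsub : {ω | ENNReal.ofReal n.RB < distT Φ ω} ⊆ {ω | ENNReal.ofReal d < distT Φ ω} :=
      fun ω hω => (ENNReal.ofReal_le_ofReal h).trans_lt hω
    rw [← measure_sdiff hsub (measurableSet_lt measurable_const hm).nullMeasurableSet (measure_ne_top _ _)]
    congr 1
    ext ω
    simp
  -- When `d ≥ R_B` the event is empty, and the truncated subtraction in `ℝ≥0∞` gives `0` as well.
  · have hle := ENNReal.ofReal_le_ofReal h
    have hsub : {ω | ENNReal.ofReal d < distT Φ ω} ⊆ {ω | ENNReal.ofReal n.RB < distT Φ ω} :=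
      fun ω hω => hle.trans_lt hω
    rw [tsub_eq_zero_of_le (measure_mono hsub)]
    convert measure_empty (μ := μ)
    ext ω
    simpa using fun h1 => hle.trans_lt h1

end IsHetNet

/-! ### Densities without case distinctions -/

namespace Network

variable (n : Network) {PL : ℝ → ℝ}

theorem one_sub_QT_pos : 0 < 1 - n.QT := n.one_sub_QT ▸ radialVoid_pos _

theorem voidL_pos (d : ℝ) : 0 < n.voidL PL d := Real.exp_pos _

theorem voidN_pos (d : ℝ) : 0 < n.voidN PL d := Real.exp_pos _

theorem pdfL_nonneg (hPL : IsLoSProbability PL) (r : ℝ) : 0 ≤ n.pdfL PL r :=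
  (n.isRadialL hPL).radialPdf_nonneg r

theorem pdfN_nonneg (hPL : IsLoSProbability PL) (r : ℝ) : 0 ≤ n.pdfN PL r :=
  (n.isRadialN hPL).radialPdf_nonneg r

theorem pdfT_nonneg (r : ℝ) : 0 ≤ n.pdfT r := by
  rw [n.pdfT_eq]; exact Set.indicator_nonneg (fun r _ => n.isRadialT.radialPdf_nonneg r) r

theorem measurable_pdfL (hPL : IsLoSProbability PL) : Measurable (n.pdfL PL) :=
  (n.isRadialL hPL).measurable_radialPdf

theorem measurable_pdfN (hPL : IsLoSProbability PL) : Measurable (n.pdfN PL) :=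
  (n.isRadialN hPL).measurable_radialPdf

theorem measurable_pdfT : Measurable n.pdfT := by
  rw [funext n.pdfT_eq]; exact n.isRadialT.measurable_radialPdf.indicator measurableSet_Iic

theorem measurable_voidL (hPL : IsLoSProbability PL) : Measurable (n.voidL PL) :=
  (n.isRadialL hPL).continuous_radialVoid.measurable

theorem measurable_voidN (hPL : IsLoSProbability PL) : Measurable (n.voidN PL) :=
  (n.isRadialN hPL).continuous_radialVoid.measurable

theorem pdfL_of_lt {r : ℝ} (hr : r < n.h) : n.pdfL PL r = 0 := if_neg hr.not_ge

theorem pdfN_of_lt {r : ℝ} (hr : r < n.h) : n.pdfN PL r = 0 := if_neg hr.not_ge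

theorem measurable_τLN : Measurable n.τLN := measurable_equivDist

theorem measurable_τNL : Measurable n.τNL := measurable_equivDist

theorem measurable_τTL : Measurable n.τTL := measurable_equivDist

theorem measurable_τLT : Measurable n.τLT := measurable_equivDist

theorem τLN_nonneg {r : ℝ} (hr : 0 ≤ r) : 0 ≤ n.τLN r := equivDist_nonneg n.ηL_pos n.ηN_pos hr

theorem τNL_nonneg {r : ℝ} (hr : 0 ≤ r) : 0 ≤ n.τNL r := equivDist_nonneg n.ηN_pos n.ηL_pos hr

theorem τTL_nonneg {r : ℝ} (hr : 0 ≤ r) : 0 ≤ n.τTL r := equivDist_nonneg n.ηT_pos n.ηL_pos hr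

theorem τLT_nonneg {r : ℝ} (hr : 0 ≤ r) : 0 ≤ n.τLT r := equivDist_nonneg n.ηL_pos n.ηT_pos hr

/-- The threshold is then at most `h`, and no ABS can be closer than its height. -/
theorem voidN_τNL {r : ℝ} (hr : 0 ≤ r) (h : r ≤ n.lLh) : n.voidN PL (n.τNL r) = 1 :=
  radialVoid_of_le (n.τNL_nonneg hr)
    ((equivDist_le_iff n.ηN_pos n.αN_pos n.ηL_pos n.αL_pos hr n.h_pos.le).2 h)

theorem voidL_τLT {r : ℝ} (hr : 0 ≤ r) (h : r ≤ n.lTL) : n.voidL PL (n.τLT r) = 1 :=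
  radialVoid_of_le (n.τLT_nonneg hr)
    ((equivDist_le_iff n.ηL_pos n.αL_pos n.ηT_pos n.αT_pos hr n.h_pos.le).2 h)

theorem τTL_le_RB_iff {r : ℝ} (hr : 0 ≤ r) : n.τTL r ≤ n.RB ↔ r ≤ n.lLT :=
  equivDist_le_iff n.ηT_pos n.αT_pos n.ηL_pos n.αL_pos hr n.RB_pos.le

/-- Probability that the nearest TBS is in the LoS ball but received more weakly than a LoS ABS at
distance `r`. -/
noncomputable def weakTBS (r : ℝ) : ℝ := max (Real.exp (-Real.pi * n.lamT * n.τTL r ^ 2) - (1 - n.QT)) 0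

theorem weakTBS_of_le {r : ℝ} (hr : 0 ≤ r) (h : r ≤ n.lLT) :
    n.weakTBS r = Real.exp (-Real.pi * n.lamT * n.τTL r ^ 2) - (1 - n.QT) := by
  refine max_eq_left ?_
  rw [n.one_sub_QT, n.voidT_eq n.RB_pos.le, sub_nonneg, Real.exp_le_exp, neg_mul, neg_mul, neg_mul,
    neg_le_neg_iff]
  have := (n.τTL_le_RB_iff hr).2 h
  have := n.τTL_nonneg hr
  have := n.lamT_pos
  gcongr

theorem weakTBS_of_lt {r : ℝ} (hr : 0 ≤ r) (h : n.lLT < r) : n.weakTBS r = 0 := by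
  refine max_eq_right ?_
  rw [n.one_sub_QT, n.voidT_eq n.RB_pos.le, sub_nonpos, Real.exp_le_exp, neg_mul, neg_mul, neg_mul,
    neg_le_neg_iff]
  have := (not_le.1 fun h1 => h.not_ge ((n.τTL_le_RB_iff hr).1 h1)).le
  have := n.RB_pos
  have := n.lamT_pos
  gcongr

theorem servingPdfL1_eq (A r : ℝ) :
    n.servingPdfL1 PL A r = n.pdfL PL r * n.voidN PL (n.τNL r) * (1 - n.QT) / A := by
  rcases lt_or_ge r n.h with hr | hr
  · simp [servingPdfL1, n.pdfL_of_lt hr]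
  have hr0 := n.h_pos.le.trans hr
  unfold servingPdfL1
  split_ifs with h
  · rw [n.voidN_τNL hr0 h]; ring
  · ring

/-- The truncation in `weakTBS` accounts for the cut at `l_{L,T}`, and `voidN_τNL` for the cut at
`l_{L,h}`. When `l_{L,T} < l_{L,h}`, the NLoS factor is `1` wherever the TBS factor can be nonzero.
-/
theorem servingPdfL2_eq (A r : ℝ) :
    n.servingPdfL2 PL A r = n.pdfL PL r * n.voidN PL (n.τNL r) * n.weakTBS r / A := by
  rcases lt_or_ge r n.h with hr | hr
  · simp [servingPdfL2, n.pdfL_of_lt hr]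
  have hr0 := n.h_pos.le.trans hr
  unfold servingPdfL2
  split_ifs with h1 h2 h3 h4
  · rw [n.voidN_τNL hr0 (h2.trans h1.le), n.weakTBS_of_le hr0 h2]; ring
  · rw [n.weakTBS_of_lt hr0 (not_le.1 h2)]; ring
  · rw [n.voidN_τNL hr0 h3, n.weakTBS_of_le hr0 (h3.trans (not_lt.1 h1))]; ring
  · rw [n.weakTBS_of_le hr0 h4]; ring
  · rw [n.weakTBS_of_lt hr0 (not_le.1 h4)]; ring

theorem servingPdfT_eq (A r : ℝ) :
    n.servingPdfT PL A r = n.pdfT r * n.voidL PL (n.τLT r) / A := by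
  unfold servingPdfT
  split_ifs with h
  · rcases lt_or_ge r 0 with hr | hr
    · simp [pdfT, hr.not_ge]
    · rw [n.voidL_τLT hr h, mul_one]
  · ring

end Network

/-! ### Laws on the association events as products of a density and void factors -/

namespace IsHetNet

variable {Ω : Type*} [MeasurableSpace Ω] {μ : Measure Ω} [IsProbabilityMeasure μ] {n : Network}
  {PL : ℝ → ℝ} {Φ : BaseStations Ω}

theorem map_distN (hΦ : IsHetNet μ n PL Φ) (hPL : IsLoSProbability PL) :
    (μ.restrict {ω | distN n Φ ω ≠ ∞ ∧
      ((distN n Φ ω).toReal, distL n Φ ω) ∈ {q : ℝ × ℝ≥0∞ | ENNReal.ofReal (n.τLN q.1) < q.2} ∧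
      ((distN n Φ ω).toReal, distT Φ ω) ∈ {q : ℝ × ℝ≥0∞ | ENNReal.ofReal n.RB < q.2}}).map
        (fun ω => (distN n Φ ω).toReal) =
      volume.withDensity fun r =>
        ENNReal.ofReal (n.pdfN PL r * n.voidL PL (n.τLN r) * (1 - n.QT)) := by
  have hi := hΦ.iIndepFun_dist
  have hmN := n.measurable_pdfN hPL
  have hτ := n.measurable_τLN
  refine (map_toReal_restrict_of_indepFun₂ hΦ.measurable_distN hΦ.measurable_distL
    hΦ.measurable_distT
    -- Indices `0`, `1`, `2` stand for TBS, LoS and NLoS.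
    (hi.indepFun_prodMk hΦ.measurable_dist 1 0 2 (by decide) (by decide)).symm
    (hi.indepFun (by decide : (1 : Fin 3) ≠ 0)) hmN.ennreal_ofReal
    (hΦ.nlos_radial.map_minDist (n.isRadialN hPL))
    (measurableSet_lt (by fun_prop) (by fun_prop))
    (measurableSet_lt (by fun_prop) (by fun_prop))).trans ?_
  congr 1; funext r
  -- Below `h` both densities vanish; this also disposes of negative `r`, where the sign of the
  -- threshold is not controlled.
  rcases lt_or_ge r n.h with hr | hr
  · simp [n.pdfN_of_lt hr]
  simp only [Set.mem_ofPred_eq]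
  rw [hΦ.measure_RB_lt_distT, hΦ.measure_lt_distL hPL (n.τLN_nonneg (n.h_pos.le.trans hr)),
    mul_assoc, ENNReal.ofReal_mul (n.pdfN_nonneg hPL r), ENNReal.ofReal_mul (n.voidL_pos _).le]

theorem map_distL_without_tbs (hΦ : IsHetNet μ n PL Φ) (hPL : IsLoSProbability PL) :
    (μ.restrict {ω | distL n Φ ω ≠ ∞ ∧
      ((distL n Φ ω).toReal, distN n Φ ω) ∈ {q : ℝ × ℝ≥0∞ | ENNReal.ofReal (n.τNL q.1) < q.2} ∧
      ((distL n Φ ω).toReal, distT Φ ω) ∈ {q : ℝ × ℝ≥0∞ | ENNReal.ofReal n.RB < q.2}}).map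
        (fun ω => (distL n Φ ω).toReal) =
      volume.withDensity fun r =>
        ENNReal.ofReal (n.pdfL PL r * n.voidN PL (n.τNL r) * (1 - n.QT)) := by
  have hi := hΦ.iIndepFun_dist
  have hmL := n.measurable_pdfL hPL
  have hτ := n.measurable_τNL
  refine (map_toReal_restrict_of_indepFun₂ hΦ.measurable_distL hΦ.measurable_distN
    hΦ.measurable_distT
    (hi.indepFun_prodMk hΦ.measurable_dist 2 0 1 (by decide) (by decide)).symm
    (hi.indepFun (by decide : (2 : Fin 3) ≠ 0)) hmL.ennreal_ofReal
    (hΦ.los_radial.map_minDist (n.isRadialL hPL))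
    (measurableSet_lt (by fun_prop) (by fun_prop))
    (measurableSet_lt (by fun_prop) (by fun_prop))).trans ?_
  congr 1; funext r
  rcases lt_or_ge r n.h with hr | hr
  · simp [n.pdfL_of_lt hr]
  simp only [Set.mem_ofPred_eq]
  rw [hΦ.measure_RB_lt_distT, hΦ.measure_lt_distN hPL (n.τNL_nonneg (n.h_pos.le.trans hr)),
    mul_assoc, ENNReal.ofReal_mul (n.pdfL_nonneg hPL r), ENNReal.ofReal_mul (n.voidN_pos _).le]

theorem map_distL_with_tbs (hΦ : IsHetNet μ n PL Φ) (hPL : IsLoSProbability PL) :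
    (μ.restrict {ω | distL n Φ ω ≠ ∞ ∧
      ((distL n Φ ω).toReal, distN n Φ ω) ∈ {q : ℝ × ℝ≥0∞ | ENNReal.ofReal (n.τNL q.1) < q.2} ∧
      ((distL n Φ ω).toReal, distT Φ ω) ∈
        {q : ℝ × ℝ≥0∞ | ENNReal.ofReal (n.τTL q.1) < q.2 ∧ q.2 ≤ ENNReal.ofReal n.RB}}).map
        (fun ω => (distL n Φ ω).toReal) =
      volume.withDensity fun r =>
        ENNReal.ofReal (n.pdfL PL r * n.voidN PL (n.τNL r) * n.weakTBS r) := by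
  have hi := hΦ.iIndepFun_dist
  have hmL := n.measurable_pdfL hPL
  have hτ := n.measurable_τNL
  have hτ' := n.measurable_τTL
  refine (map_toReal_restrict_of_indepFun₂ hΦ.measurable_distL hΦ.measurable_distN
    hΦ.measurable_distT
    (hi.indepFun_prodMk hΦ.measurable_dist 2 0 1 (by decide) (by decide)).symm
    (hi.indepFun (by decide : (2 : Fin 3) ≠ 0)) hmL.ennreal_ofReal
    (hΦ.los_radial.map_minDist (n.isRadialL hPL))
    (measurableSet_lt (by fun_prop) (by fun_prop))
    (MeasurableSet.inter
      (measurableSet_lt (f := fun q : ℝ × ℝ≥0∞ => ENNReal.ofReal (n.τTL q.1)) (g := Prod.snd)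
        (by fun_prop) (by fun_prop))
      (measurableSet_le (f := Prod.snd) (g := fun _ => ENNReal.ofReal n.RB)
        (by fun_prop) (by fun_prop)))).trans ?_
  congr 1; funext r
  rcases lt_or_ge r n.h with hr | hr
  · simp [n.pdfL_of_lt hr]
  have hr0 := n.h_pos.le.trans hr
  simp only [Set.mem_inter_iff, Set.mem_ofPred_eq]
  rw [hΦ.measure_lt_distT_le (n.τTL_nonneg hr0), hΦ.measure_lt_distN hPL (n.τNL_nonneg hr0),
    mul_assoc (n.pdfL PL r), ENNReal.ofReal_mul (n.pdfL_nonneg hPL r), ENNReal.ofReal_mul (n.voidN_pos _).le,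
    Network.weakTBS, ENNReal.ofReal_max, ENNReal.ofReal_zero, max_eq_left zero_le]

theorem map_distT (hΦ : IsHetNet μ n PL Φ) (hPL : IsLoSProbability PL) (hTN : n.RB ≤ n.lTN) :
    (μ.restrict (assocT n Φ)).map (fun ω => (distT Φ ω).toReal) =
      volume.withDensity fun r => ENNReal.ofReal (n.pdfT r * n.voidL PL (n.τLT r)) := by
  have hi := hΦ.iIndepFun_dist
  have hτ := n.measurable_τLT
  have hτ' : Measurable (equivDist n.ηN n.αN n.ηT n.αT) := measurable_equivDist
  rw [assocT_eq]
  refine (map_toReal_restrict_of_indepFun₂ hΦ.measurable_distT hΦ.measurable_distL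
    hΦ.measurable_distN
    (hi.indepFun_prodMk hΦ.measurable_dist 1 2 0 (by decide) (by decide)).symm
    (hi.indepFun (by decide : (1 : Fin 3) ≠ 2)) n.isRadialT.measurable_radialPdf.ennreal_ofReal
    (hΦ.tbs_radial.map_minDist n.isRadialT)
    (measurableSet_lt (by fun_prop) (by fun_prop))
    (MeasurableSet.inter
      (measurableSet_lt (f := fun q : ℝ × ℝ≥0∞ => ENNReal.ofReal (equivDist n.ηN n.αN n.ηT n.αT q.1)) (g := Prod.snd)
        (by fun_prop) (by fun_prop))
      (measurableSet_le (f := fun q : ℝ × ℝ≥0∞ => q.1) (g := fun _ => n.RB)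
        (by fun_prop) (by fun_prop)))).trans ?_
  congr 1; funext r
  simp only [Set.mem_inter_iff, Set.mem_ofPred_eq]
  by_cases hr : r ≤ n.RB
  · rcases lt_or_ge r 0 with hr0 | hr0
    · simp [radialPdf, Network.pdfT, hr0.not_ge]
    -- Since `r ≤ R_B ≤ l_{T,N}`, the NLoS threshold is at most `h`: NLoS ABSs almost surely never
    -- outperform a TBS in the ball.
    have h1 : n.voidN PL (equivDist n.ηN n.αN n.ηT n.αT r) = 1 :=
      radialVoid_of_le (equivDist_nonneg n.ηN_pos n.ηT_pos hr0)
        ((equivDist_le_iff n.ηN_pos n.αN_pos n.ηT_pos n.αT_pos hr0 n.h_pos.le).2 (hr.trans hTN))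
    simp only [hr, and_true]
    rw [hΦ.measure_lt_distL hPL (n.τLT_nonneg hr0),
      hΦ.measure_lt_distN hPL (equivDist_nonneg n.ηN_pos n.ηT_pos hr0), h1, n.pdfT_eq,
      Set.indicator_of_mem (Set.mem_Iic.2 hr), ENNReal.ofReal_one, mul_one,
      ENNReal.ofReal_mul (n.isRadialT.radialPdf_nonneg r)]
  · simp [hr, n.pdfT_eq]

end IsHetNet

end UAVHetNet
-- Conditional densities of the serving distances
open UAVHetNet
theorem mainTheorem5 {Ω : Type*} [MeasurableSpace Ω] (μ : Measure Ω) [IsProbabilityMeasure μ]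
    (n : Network) (PL : ℝ → ℝ) (hPL : IsLoSProbability PL)
    (Φ : BaseStations Ω) (hΦ : IsHetNet μ n PL Φ) :
    -- association with a NLoS ABS, which never happens when a TBS lies in the LoS ball
    ((∀ᵐ ω ∂μ, ω ∈ tbsInBall n Φ → ω ∉ assocN n Φ) →
      0 < μ.real (assocN n Φ) ∧
      HasDensity (μ[|assocN n Φ]) (fun ω => (distN n Φ ω).toReal)
        (n.servingPdfN PL (μ.real (assocN n Φ)))) ∧
    -- association with a LoS ABS: the parts without and with a TBS in the LoS ball, and the sum
    (0 < μ.real (assocL n Φ) ∧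
      HasDensity ((μ[|assocL n Φ]).restrict (tbsInBall n Φ)ᶜ) (fun ω => (distL n Φ ω).toReal)
        (n.servingPdfL1 PL (μ.real (assocL n Φ))) ∧
      HasDensity ((μ[|assocL n Φ]).restrict (tbsInBall n Φ)) (fun ω => (distL n Φ ω).toReal)
        (n.servingPdfL2 PL (μ.real (assocL n Φ))) ∧
      HasDensity (μ[|assocL n Φ]) (fun ω => (distL n Φ ω).toReal)
        (fun r => n.servingPdfL1 PL (μ.real (assocL n Φ)) r +
          n.servingPdfL2 PL (μ.real (assocL n Φ)) r)) ∧
    -- association with a TBS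
    (n.lTL ≤ n.RB → n.RB ≤ n.lTN →
      0 < μ.real (assocT n Φ) ∧
      HasDensity (μ[|assocT n Φ]) (fun ω => (distT Φ ω).toReal)
        (n.servingPdfT PL (μ.real (assocT n Φ)))) := by
  have hmT := hΦ.measurable_distT.ennreal_toReal
  have hmL := hΦ.measurable_distL.ennreal_toReal
  have hmN := hΦ.measurable_distN.ennreal_toReal
  have hE := hΦ.measurableSet_tbsInBall
  have hpL := n.measurable_pdfL hPL
  have hpN := n.measurable_pdfN hPL
  have hpT := n.measurable_pdfT
  have hvL := n.measurable_voidL hPL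
  have hvN := n.measurable_voidN hPL
  have hQ := n.one_sub_QT_pos
  -- The ABS densities are positive everywhere beyond `h`; the length `1` of the interval is
  -- arbitrary.
  have hlt : n.h < n.h + 1 := lt_add_one _
  refine ⟨fun h => ?_, ?_, fun _ hTN => ?_⟩
  · have hτ := n.measurable_τLN
    have hg : Measurable fun r => n.pdfN PL r * n.voidL PL (n.τLN r) * (1 - n.QT) := by fun_prop
    have hA := hΦ.assocN_ae_eq h
    have hpos : 0 < μ.real (assocN n Φ) :=
      measureReal_pos_of_map_restrict hA.symm.le (hΦ.map_distN hPL) hlt (fun r hr =>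
        mul_pos (mul_pos ((n.isRadialN hPL).radialPdf_pos hr.1) (n.voidL_pos _)) hQ) hg
    exact ⟨hpos, hasDensity_cond hmN hA hpos (hΦ.map_distN hPL) hg
      (fun r => mul_nonneg (mul_nonneg (n.pdfN_nonneg hPL r) (n.voidL_pos _).le) hQ.le)
      fun r => by unfold Network.servingPdfN; ring⟩
  · have hτ := n.measurable_τNL
    have hw : Measurable n.weakTBS := by
      have := n.measurable_τTL
      unfold Network.weakTBS; fun_prop
    have hg₁ : Measurable fun r => n.pdfL PL r * n.voidN PL (n.τNL r) * (1 - n.QT) := by fun_prop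
    have hg₂ : Measurable fun r => n.pdfL PL r * n.voidN PL (n.τNL r) * n.weakTBS r := by fun_prop
    -- The part without a TBS in the ball alone has positive mass.
    have hpos : 0 < μ.real (assocL n Φ) :=
      measureReal_pos_of_map_restrict
        (hΦ.assocL_inter_compl_ae_eq.symm.le.trans Set.inter_subset_left.eventuallyLE)
        (hΦ.map_distL_without_tbs hPL) hlt (fun r hr =>
        mul_pos (mul_pos ((n.isRadialL hPL).radialPdf_pos hr.1) (n.voidN_pos _)) hQ) hg₁
    have h₁ := hasDensity_restrict_cond hmL hE.compl hΦ.assocL_inter_compl_ae_eq hpos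
      (hΦ.map_distL_without_tbs hPL) hg₁
      (fun r => mul_nonneg (mul_nonneg (n.pdfL_nonneg hPL r) (n.voidN_pos _).le) hQ.le)
      (n.servingPdfL1_eq _)
    have h₂ := hasDensity_restrict_cond hmL hE hΦ.assocL_inter_ae_eq hpos
      (hΦ.map_distL_with_tbs hPL) hg₂
      (fun r => mul_nonneg (mul_nonneg (n.pdfL_nonneg hPL r) (n.voidN_pos _).le)
        (le_max_right _ _))
      (n.servingPdfL2_eq _)
    exact ⟨hpos, h₁, h₂, HasDensity.add hmL hE h₁ h₂⟩
  · have hτ := n.measurable_τLT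
    have hg : Measurable fun r => n.pdfT r * n.voidL PL (n.τLT r) := by fun_prop
    have hpos : 0 < μ.real (assocT n Φ) :=
      measureReal_pos_of_map_restrict (Filter.EventuallyLE.refl _ _) (hΦ.map_distT hPL hTN)
        n.RB_pos (fun r hr => mul_pos (by
          rw [n.pdfT_eq, Set.indicator_of_mem (Set.mem_Iic.2 hr.2.le)]
          exact n.isRadialT.radialPdf_pos hr.1) (n.voidL_pos _)) hg
    exact ⟨hpos, hasDensity_cond hmT (Filter.EventuallyEq.refl _ _) hpos (hΦ.map_distT hPL hTN) hg
      (fun r => mul_nonneg (n.pdfT_nonneg r) (n.voidL_pos _).le) (n.servingPdfT_eq _)⟩
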